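/- Model. A network is a finite connected undirected graph $G=(V,E,\omega)$ with $n$ nodes, positive integer edge weights $\omega$ and weighted diameter $D_\omega$. The nodes have distinct identifiers in $\{1,\dots,n^{a}\}$ for a constant $a$. Each node knows its identifier, $n$, the smallest identifier, the identifiers of its neighbours and the weights of the edges to them, whether it belongs to a given nonempty set $S\subseteq V$, and $|S|$. Computation proceeds in synchronous rounds; in each round every node may send one message of $O(\log (n+D_\omega))$ bits (a constant number of identifiers, distances and routing costs) to each neighbour. For a subgraph $T$ containing $S$ let $RC_S(T)=\sum_{u,v\in S}\omega_T(u,v)$, where $\omega_T$ is the weighted distance in $T$. The $S$-minimum routing cost tree problem asks for a subtree $T$ of $G$ that spans $S$ and minimizes $RC_S(T)$. Theorem. Assume that either all edge weights are equal and a message takes one round to cross an edge, or a message takes exactly $\omega(e)$ rounds to cross the edge $e$ (a new message may enter the edge in every round). There is a deterministic distributed algorithm, MRCT, the same for all networks, that computes a $(\times,2)$-approximation of the $S$-minimum routing cost tree problem in $O(|S|+D_\omega)$ rounds, the constant being absolute. More precisely, within this time all nodes terminate, and there are spanning trees $T_r$ of $G$, one for each $r\in S$, such that 1. $T_r$ is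 a shortest-path tree of $G$ with root $r$, and every node $u$ knows its parent in $T_r$ and its distance $\omega(r,u)$, for all $r\in S$; 2. every node $u$ knows, for all $r\in S$, the number $z_r(u)$ of nodes of $S$ in the subtree of $T_r$ below $u$ and the value $rc_r(u)$ given by the recursion $rc_r(u)=\sum_{c}\bigl(rc_r(c)+\omega(u,c)\,z_r(c)\,(|S|-z_r(c))\bigr)$ over the children $c$ of $u$ in $T_r$; at the root, $2\,rc_r(r)=RC_S(T_r)$; 3. every node knows (the identifier of) one and the same node $v\in S$ such that $RC_S(T_v)=\min_{r\in S}RC_S(T_r)$, and $\mathrm{OPT}\le RC_S(T_v)\le 2\,\mathrm{OPT}$, where $\mathrm{OPT}$ is the minimum of $RC_S(T)$ over all subtrees $T$ of $G$ that span $S$. -/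

import Mathlib

noncomputable section

namespace MRCT

/-! ## Weighted graphs, routing cost, and the minimum routing cost tree problem -/

section Graphs

variable {V : Type}

/-- Total weight of a walk: the sum of the weights of its edges. -/
def walkWeight {H : SimpleGraph V} (w : Sym2 V → ℕ) {u v : V} (p : H.Walk u v) : ℕ :=
  (p.edges.map w).sum

/-- Weighted distance between `u` and `v` using only edges of `H`: the least weight of a
`u`-`v`-walk of `H`.  (Only used for vertices that are connected in `H`.) -/
def wdist (H : SimpleGraph V) (w : Sym2 V → ℕ) (u v : V) : ℕ :=
  sInf (Set.range fun p : H.Walk u v => walkWeight w p)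

/-- `T` is a subtree of `G` that spans `S`. -/
def SpansAsTree (G : SimpleGraph V) (S : Finset V) (T : G.Subgraph) : Prop :=
  T.coe.IsTree ∧ (S : Set V) ⊆ T.verts

/-- Routing cost of a subgraph `T` with respect to `S`: the sum over all (ordered) pairs
`u, v ∈ S` of the distance from `u` to `v` inside `T`. -/
def routingCost {G : SimpleGraph V} (w : Sym2 V → ℕ) (S : Finset V) (T : G.Subgraph) : ℕ :=
  ∑ u ∈ S, ∑ v ∈ S, wdist T.spanningCoe w u v

/-- Optimal value of the `S`-minimum routing cost tree problem on `(G, w)`. -/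
def optRoutingCost (G : SimpleGraph V) (w : Sym2 V → ℕ) (S : Finset V) : ℕ :=
  sInf {c | ∃ T : G.Subgraph, SpansAsTree G S T ∧ c = routingCost w S T}

/-- One-sided multiplicative approximation with factor `ρ` for a minimization problem. -/
def IsMulApprox (ρ opt sol : ℕ) : Prop :=
  opt ≤ sol ∧ sol ≤ ρ * opt

/-- `T` is a spanning tree of `G` in which every node is at its `G`-distance from `r`. -/
def IsShortestPathTree (G : SimpleGraph V) (w : Sym2 V → ℕ) (r : V) (T : G.Subgraph) : Prop :=
  T.IsSpanning ∧ T.coe.IsTree ∧ ∀ u, wdist T.spanningCoe w r u = wdist G w r u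

end Graphs

/-! ## Networks and synchronous message-passing algorithms -/

/-- A network: a finite connected graph with positive integer edge weights and distinct
positive node identifiers.  `latency e` is the number of rounds that a message needs to
travel through the edge `e`. -/
structure Network (V : Type) [Fintype V] where
  graph : SimpleGraph V
  connected : graph.Connected
  weight : Sym2 V → ℕ
  weight_pos : ∀ e ∈ graph.edgeSet, 0 < weight e
  latency : Sym2 V → ℕ
  latency_pos : ∀ e ∈ graph.edgeSet, 0 < latency e
  ident : V → ℕ
  ident_injective : Function.Injective ident
  ident_pos : ∀ v, 0 < ident v

/-- What a node knows at the beginning: its own identifier, the number of nodes of the network,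
the smallest identifier, the identifiers of its neighbors together with the weights of the
connecting edges, whether it belongs to `S`, and the size of `S`. -/
structure LocalInput where
  ident : ℕ
  numNodes : ℕ
  minIdent : ℕ
  links : Finset (ℕ × ℕ)
  inS : Prop
  sizeS : ℕ

/-- A message is a string of bits. -/
abbrev Message := List Bool

/-- A deterministic synchronous message-passing algorithm.  In every round, each node may send,
to each neighbor separately (addressed by its identifier), at most one message that depends on
its state, and then updates its state from the messages that arrive (indexed by the identifier
of the neighbor they come from).  `output s = some o` means that the node has terminated with
result `o`.  Local computation is free. -/
structure Algorithm (Out : Type) where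
  State : Type
  init : LocalInput → State
  send : State → ℕ → Option Message
  step : State → (ℕ → Option Message) → State
  output : State → Option Out

section Execution

variable {V : Type} [Fintype V]

open scoped Classical in
/-- The initial knowledge of node `u`. -/
def Network.localInput (N : Network V) (S : Finset V) (u : V) : LocalInput where
  ident := N.ident u
  numNodes := Fintype.card V
  minIdent := sInf (Set.range N.ident)
  links := (Finset.univ.filter fun v => N.graph.Adj u v).image
    fun v => (N.ident v, N.weight s(u, v))
  inS := u ∈ S
  sizeS := S.card

open scoped Classical in
/-- The neighbor of `u` whose identifier is `i`, if there is one. -/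
def Network.neighbor (N : Network V) (u : V) (i : ℕ) : Option V :=
  if h : ∃ v, N.graph.Adj u v ∧ N.ident v = i then some h.choose else none

/-- The state of node `u` after `t` rounds.  A message that is sent through an edge of latency
`ℓ` on the basis of the state at time `t'` enters the state of the recipient at time `t' + ℓ`. -/
def Network.run {Out : Type} (N : Network V) (S : Finset V) (A : Algorithm Out) :
    ℕ → V → A.State
  | 0, u => A.init (N.localInput S u)
  | t + 1, u =>
    A.step (N.run S A t u) fun i =>
      (N.neighbor u i).bind fun v =>
        if _h : 0 < N.latency s(u, v) ∧ N.latency s(u, v) ≤ t + 1 then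
          A.send (N.run S A (t + 1 - N.latency s(u, v)) v) (N.ident u)
        else none
termination_by t => t
decreasing_by all_goals omega

/-- No message that is ever sent has more than `B` bits. -/
def Network.BandwidthAtMost {Out : Type} (N : Network V) (S : Finset V) (A : Algorithm Out)
    (B : ℕ) : Prop :=
  ∀ (t : ℕ) (u v : V), N.graph.Adj u v →
    ∀ m ∈ A.send (N.run S A t u) (N.ident v), m.length ≤ B

/-- Every node `u` terminates within `T` rounds, irrevocably, with result `out u`. -/
def Network.TerminatesWithin {Out : Type} (N : Network V) (S : Finset V) (A : Algorithm Out)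
    (T : ℕ) (out : V → Out) : Prop :=
  ∀ u, ∃ t ≤ T, (∀ s < t, A.output (N.run S A s u) = none) ∧
    ∀ s, t ≤ s → A.output (N.run S A s u) = some (out u)

/-- Weighted diameter. -/
def Network.diam (N : Network V) : ℕ :=
  Finset.univ.sup fun u => Finset.univ.sup fun v => wdist N.graph N.weight u v

/-- All edges have the same weight, and every message arrives after one round. -/
def Network.UniformWeights (N : Network V) : Prop :=
  (∃ c, ∀ e ∈ N.graph.edgeSet, N.weight e = c) ∧ ∀ e ∈ N.graph.edgeSet, N.latency e = 1

/-- The weight of each edge is the time that a message needs to travel through it. -/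
def Network.TransmissionWeights (N : Network V) : Prop :=
  ∀ e ∈ N.graph.edgeSet, N.latency e = N.weight e

end Execution

/-! ## The result of the algorithm -/

/-- The variables held by a node at the end.  `parent r`, `dist r`, `subtreeSize r` and
`subtreeCost r` refer to the tree whose root has identifier `r`; `best` is the identifier of
the root of the selected tree. -/
structure Result where
  parent : ℕ → Option ℕ
  dist : ℕ → ℕ
  subtreeSize : ℕ → ℕ
  subtreeCost : ℕ → ℕ
  best : ℕ

section Results

variable {V : Type} [Fintype V]

/-- The nodes store the shortest-path tree `T` with root `r`: each node knows its distance to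
`r`, and the edges of `T` are exactly those between a node and its parent. -/
def Network.StoresTree (N : Network V) (out : V → Result) (r : V) (T : N.graph.Subgraph) : Prop :=
  IsShortestPathTree N.graph N.weight r T ∧
  (∀ u, (out u).dist (N.ident r) = wdist N.graph N.weight r u) ∧
  (out r).parent (N.ident r) = none ∧
  ∀ u v, T.Adj u v ↔
    (out u).parent (N.ident r) = some (N.ident v) ∨ (out v).parent (N.ident r) = some (N.ident u)

/-- The children of `u` in the stored tree with root `r`. -/
def Network.children (N : Network V) (out : V → Result) (r u : V) : Finset V :=
  Finset.univ.filter fun c => (out c).parent (N.ident r) = some (N.ident u)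

open scoped Classical in
/-- The nodes store the routing costs of the tree with root `r`, computed recursively from the
leaves: `subtreeSize` is the number of nodes of `S` in the subtree below `u`, and each edge from
`u` to a child `c` contributes its weight times the number of (unordered) pairs of nodes of `S`
that it separates. -/
def Network.StoresCosts (N : Network V) (S : Finset V) (out : V → Result) (r : V) : Prop :=
  ∀ u,
    (out u).subtreeSize (N.ident r) =
      (if u ∈ S then 1 else 0) + ∑ c ∈ N.children out r u, (out c).subtreeSize (N.ident r) ∧
    (out u).subtreeCost (N.ident r) =
      ∑ c ∈ N.children out r u, ((out c).subtreeCost (N.ident r) +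
        N.weight s(u, c) * (out c).subtreeSize (N.ident r) *
          (S.card - (out c).subtreeSize (N.ident r)))

end Results

end MRCT

end

/-! Approximation. In a shortest-path tree `T_r`, going through the root gives `d_T(u,v) ≤ d(r,u) +
d(r,v)`, so `RC(T_r) ≤ 2|S| ∑_{u∈S} d(r,u)`. Summing over `r ∈ S` and using that distances in an
optimal tree are at least those in `G`, the `|S|` trees cost at most `2|S|·OPT` together, and the
cheapest one costs at most `2·OPT` (`isMulApprox_of_forall_le`). The cost of a tree splits over its
edges: an edge with `z` nodes of `S` below it separates `z(|S|-z)` unordered pairs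
(`sum_sum_sepWeight`), which gives the recursion for `rc`.

Pipelining. At a node `u` order the sources by distance, then identifier, and let `slot r u` be the
distance of `r` plus the number of sources that precede it. Slots of distinct sources differ, so
announcing `r` in round `slot r u` never needs two announcements at once. If `v` precedes `u` on a
shortest path from `r`, every source preceding `r` at `v` also precedes it at `u`, hence `slot r v +
w(u,v) ≤ slot r u` (`slot_add_weight_le`). Since latencies are at most weights, the announcement of
`v` reaches `u` in time, and estimates that are not yet final never cause an announcement
(`lt_add_rank`).

Synchronization. Slots are below `D + |S|`, but the nodes do not know `D`. The source of least
identifier counts the finished nodes along its tree; the round `B ≤ 2(D + |S|)` in which the count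
reaches `n` bounds all slots and all distances from `S`. By time `2B` every node has learnt `B`.

Second stage. Running the schedule backwards, `u` reports to its parent in `T_r` in round `3B - slot
r u`. The slot inequality now says that reports of children arrive before that of their parent is
due. At time `3B` all roots know their costs, and flooding the minimum takes at most `B` more
rounds, so everything ends at time `4B ≤ 8(D + |S|)`. -/

noncomputable section

namespace MRCT

open scoped Classical

/-! ## Weighted distances -/

section Distances

variable {V : Type} {H : SimpleGraph V} {w : Sym2 V → ℕ}

theorem walkWeight_nil (u : V) : walkWeight w (SimpleGraph.Walk.nil : H.Walk u u) = 0 := by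
  simp [walkWeight]

theorem walkWeight_cons {u v x : V} (h : H.Adj u v) (p : H.Walk v x) :
    walkWeight w (SimpleGraph.Walk.cons h p) = w s(u, v) + walkWeight w p := by
  simp [walkWeight]

theorem walkWeight_append {u v x : V} (p : H.Walk u v) (q : H.Walk v x) :
    walkWeight w (p.append q) = walkWeight w p + walkWeight w q := by
  simp [walkWeight, SimpleGraph.Walk.edges_append]

theorem walkWeight_reverse {u v : V} (p : H.Walk u v) :
    walkWeight w p.reverse = walkWeight w p := by
  simp [walkWeight, SimpleGraph.Walk.edges_reverse]

theorem wdist_le_walkWeight {u v : V} (p : H.Walk u v) : wdist H w u v ≤ walkWeight w p :=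
  Nat.sInf_le ⟨p, rfl⟩

theorem exists_walkWeight_eq_wdist {u v : V} (h : H.Reachable u v) :
    ∃ p : H.Walk u v, walkWeight w p = wdist H w u v := by
  obtain ⟨p⟩ := h
  exact Nat.sInf_mem (s := Set.range fun p : H.Walk u v => walkWeight w p) ⟨_, p, rfl⟩

theorem wdist_self (u : V) : wdist H w u u = 0 := by
  have := wdist_le_walkWeight (w := w) (SimpleGraph.Walk.nil : H.Walk u u)
  rw [walkWeight_nil] at this
  omega

theorem wdist_comm (u v : V) : wdist H w u v = wdist H w v u := by
  unfold wdist
  congr 1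
  ext c
  constructor <;> rintro ⟨p, rfl⟩ <;> exact ⟨p.reverse, walkWeight_reverse p⟩

theorem wdist_triangle (hc : H.Connected) (u v x : V) :
    wdist H w u x ≤ wdist H w u v + wdist H w v x := by
  obtain ⟨p, hp⟩ := exists_walkWeight_eq_wdist (w := w) (hc u v)
  obtain ⟨q, hq⟩ := exists_walkWeight_eq_wdist (w := w) (hc v x)
  rw [← hp, ← hq, ← walkWeight_append]
  exact wdist_le_walkWeight _

theorem wdist_le_of_adj {u v : V} (h : H.Adj u v) : wdist H w u v ≤ w s(u, v) := by
  have := wdist_le_walkWeight (w := w) (SimpleGraph.Walk.cons h SimpleGraph.Walk.nil)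
  rwa [walkWeight_cons, walkWeight_nil, add_zero] at this

theorem wdist_le_wdist_add_weight (hc : H.Connected) (r : V) {u v : V} (h : H.Adj u v) :
    wdist H w r u ≤ wdist H w r v + w s(u, v) := by
  have h1 := wdist_triangle (w := w) hc r v u
  have h2 := wdist_le_of_adj (w := w) h.symm
  rw [Sym2.eq_swap] at h2
  omega

/-- The second vertex of a shortest walk from `u` to `r` serves. This supplies the parents of the
shortest-path trees. -/
theorem exists_adj_wdist_add_weight (hc : H.Connected) {r u : V} (h : u ≠ r) :
    ∃ v, H.Adj u v ∧ wdist H w r v + w s(u, v) = wdist H w r u := by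
  obtain ⟨p, hp⟩ := exists_walkWeight_eq_wdist (w := w) (hc u r)
  cases p with
  | nil => exact absurd rfl h
  | @cons _ v _ hadj q =>
    refine ⟨v, hadj, ?_⟩
    rw [walkWeight_cons, wdist_comm] at hp
    have h1 := wdist_le_walkWeight (w := w) q
    have h2 := wdist_le_wdist_add_weight (w := w) hc r hadj
    rw [wdist_comm] at h1
    omega

theorem wdist_anti {H' : SimpleGraph V} (hle : H' ≤ H) {u v : V} (h : H'.Reachable u v) :
    wdist H w u v ≤ wdist H' w u v := by
  obtain ⟨p, hp⟩ := exists_walkWeight_eq_wdist (w := w) h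
  rw [← hp]
  have := wdist_le_walkWeight (w := w) (p.mapLe hle)
  simpa [walkWeight, SimpleGraph.Walk.edges_mapLe_eq_edges] using this

end Distances

/-! ## Shortest-path trees given by parent maps -/

section ParentMaps

variable {V : Type}

/-- `P` maps every vertex other than `r` to a neighbor that precedes it on a shortest path
from `r`. -/
structure IsParentMap (G : SimpleGraph V) (w : Sym2 V → ℕ) (r : V) (P : V → V) : Prop where
  root : P r = r
  adj : ∀ u, u ≠ r → G.Adj u (P u)
  dist : ∀ u, u ≠ r → wdist G w r (P u) + w s(u, P u) = wdist G w r u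

/-- The spanning tree whose edges join the vertices other than `r` to their parents. -/
def parentTree {G : SimpleGraph V} {r : V} {P : V → V} (hP : ∀ u, u ≠ r → G.Adj u (P u)) :
    G.Subgraph where
  verts := Set.univ
  Adj u v := (u ≠ r ∧ P u = v) ∨ (v ≠ r ∧ P v = u)
  adj_sub := by
    rintro u v (⟨h, rfl⟩ | ⟨h, rfl⟩)
    · exact hP u h
    · exact (hP v h).symm
  edge_vert := fun _ => Set.mem_univ _
  symm := ⟨fun _ _ h => h.symm⟩

namespace IsParentMap

variable {G : SimpleGraph V} {w : Sym2 V → ℕ} {r : V} {P : V → V}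

theorem dist_parent_lt (hP : IsParentMap G w r P) (hw : ∀ e ∈ G.edgeSet, 0 < w e) {u : V}
    (hu : u ≠ r) : wdist G w r (P u) < wdist G w r u := by
  have h1 := hP.dist u hu
  have h2 := hw s(u, P u) (hP.adj u hu)
  omega

theorem dist_parent_le (hP : IsParentMap G w r P) (u : V) :
    wdist G w r (P u) ≤ wdist G w r u := by
  by_cases hu : u = r
  · rw [hu, hP.root]
  · have h1 := hP.dist u hu
    omega

theorem parentTree_adj_parent (hP : IsParentMap G w r P) {u : V} (hu : u ≠ r) :
    (parentTree hP.adj).spanningCoe.Adj u (P u) := Or.inl ⟨hu, rfl⟩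

theorem dist_iterate_le (hP : IsParentMap G w r P) (k : ℕ) (u : V) :
    wdist G w r (P^[k] u) ≤ wdist G w r u := by
  induction k generalizing u with
  | zero => exact le_rfl
  | succ k ih => exact (ih (P u)).trans (hP.dist_parent_le u)

theorem exists_walk_root (hP : IsParentMap G w r P) (hw : ∀ e ∈ G.edgeSet, 0 < w e) (u : V) :
    ∃ p : (parentTree hP.adj).spanningCoe.Walk u r, walkWeight w p ≤ wdist G w r u := by
  induction hd : wdist G w r u using Nat.strong_induction_on generalizing u with
  | _ d ih =>
    by_cases hu : u = r
    · subst hu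
      exact ⟨SimpleGraph.Walk.nil, by simp [walkWeight_nil]⟩
    · obtain ⟨p, hp⟩ := ih _ (hd ▸ hP.dist_parent_lt hw hu) (P u) rfl
      refine ⟨SimpleGraph.Walk.cons (hP.parentTree_adj_parent hu) p, ?_⟩
      have := hP.dist u hu
      rw [walkWeight_cons]
      omega

theorem parentTree_spanningCoe_connected (hP : IsParentMap G w r P)
    (hw : ∀ e ∈ G.edgeSet, 0 < w e) : (parentTree hP.adj).spanningCoe.Connected := by
  have : Nonempty V := ⟨r⟩
  refine ⟨fun u v => ?_⟩
  obtain ⟨p, -⟩ := hP.exists_walk_root hw u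
  obtain ⟨q, -⟩ := hP.exists_walk_root hw v
  exact ⟨p.append q.reverse⟩

end IsParentMap

variable [Fintype V]

/-- The vertices from which iterating `P` leads to `u`. -/
def descendants (P : V → V) (u : V) : Finset V :=
  Finset.univ.filter fun y => ∃ k, P^[k] y = u

/-- The vertices other than the root `r` that `P` maps to `u`. -/
def childrenOf (r : V) (P : V → V) (u : V) : Finset V :=
  Finset.univ.filter fun c => c ≠ r ∧ P c = u

/-- The contribution of the edge between `x` and its parent to the tree distance of `u`
and `v`. -/
def sepWeight (w : Sym2 V → ℕ) (P : V → V) (u v x : V) : ℕ :=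
  if (u ∈ descendants P x ↔ v ∈ descendants P x) then 0 else w s(x, P x)

theorem mem_descendants {P : V → V} {u y : V} : y ∈ descendants P u ↔ ∃ k, P^[k] y = u := by
  simp [descendants]

theorem mem_childrenOf {r : V} {P : V → V} {u c : V} : c ∈ childrenOf r P u ↔ c ≠ r ∧ P c = u := by
  simp [childrenOf]

theorem self_mem_descendants (P : V → V) (u : V) : u ∈ descendants P u :=
  mem_descendants.2 ⟨0, rfl⟩

/-- Consequently, when one endpoint moves from `u` to its parent, the sum of `sepWeight` over all
`x` can change only in the term `x = u`. -/
theorem mem_descendants_iff_parent {P : V → V} {x u : V} (h : x ≠ u) :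
    u ∈ descendants P x ↔ P u ∈ descendants P x := by
  simp only [mem_descendants]
  constructor
  · rintro ⟨k, hk⟩
    cases k with
    | zero => exact absurd hk.symm h
    | succ k => exact ⟨k, by simpa using hk⟩
  · rintro ⟨k, hk⟩
    exact ⟨k + 1, by simpa using hk⟩

namespace IsParentMap

variable {G : SimpleGraph V} {w : Sym2 V → ℕ} {r : V} {P : V → V}

theorem dist_le_of_mem_descendants (hP : IsParentMap G w r P) {u y : V}
    (h : y ∈ descendants P u) : wdist G w r u ≤ wdist G w r y := by
  obtain ⟨k, rfl⟩ := mem_descendants.1 h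
  exact hP.dist_iterate_le k y

theorem mem_descendants_root (hP : IsParentMap G w r P) (hw : ∀ e ∈ G.edgeSet, 0 < w e) (y : V) :
    y ∈ descendants P r := by
  induction hd : wdist G w r y using Nat.strong_induction_on generalizing y with
  | _ d ih =>
    by_cases hy : y = r
    · rw [hy]
      exact self_mem_descendants P r
    · rw [mem_descendants_iff_parent (Ne.symm hy)]
      exact ih _ (hd ▸ hP.dist_parent_lt hw hy) _ rfl

theorem parent_notMem_descendants (hP : IsParentMap G w r P) (hw : ∀ e ∈ G.edgeSet, 0 < w e)
    {u : V} (hu : u ≠ r) : P u ∉ descendants P u := fun h =>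
  (hP.dist_le_of_mem_descendants h).not_gt (hP.dist_parent_lt hw hu)

theorem descendants_eq (hP : IsParentMap G w r P) (u : V) :
    descendants P u = insert u ((childrenOf r P u).biUnion (descendants P)) := by
  ext y
  simp only [Finset.mem_insert, Finset.mem_biUnion, mem_childrenOf, mem_descendants]
  constructor
  · rintro ⟨k, hk⟩
    induction k generalizing y with
    | zero => exact Or.inl hk
    | succ k ih =>
      by_cases hyr : y = r
      · left
        rw [← hk, hyr]
        exact ((Function.iterate_fixed hP.root (k + 1))).symm
      rcases ih (P y) (by simpa using hk) with h | ⟨c, hc, j, hj⟩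
      · exact Or.inr ⟨y, ⟨hyr, h⟩, 0, rfl⟩
      · exact Or.inr ⟨c, hc, j + 1, by simpa using hj⟩
  · rintro (rfl | ⟨c, ⟨_, rfl⟩, k, rfl⟩)
    · exact ⟨0, rfl⟩
    · exact ⟨k + 1, by rw [Function.iterate_succ_apply']⟩

/-- A common descendant would make one child an iterated parent of the other, hence of `u`, although
it is farther from `r` than `u`. -/
theorem disjoint_descendants (hP : IsParentMap G w r P) (hw : ∀ e ∈ G.edgeSet, 0 < w e)
    {u c c' : V} (hc : c ∈ childrenOf r P u) (hc' : c' ∈ childrenOf r P u) (hne : c ≠ c') :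
    Disjoint (descendants P c) (descendants P c') := by
  have key : ∀ {c c' : V}, c ∈ childrenOf r P u → c' ∈ childrenOf r P u → c ≠ c' →
      ∀ j, P^[j] c ≠ c' := by
    intro c c' hc hc' hne j hj
    cases j with
    | zero => exact hne hj
    | succ j =>
      rw [mem_childrenOf] at hc hc'
      rw [Function.iterate_succ_apply, hc.2] at hj
      have h1 := hP.dist_iterate_le j u
      rw [hj] at h1
      have h2 := hP.dist_parent_lt hw hc'.1
      rw [hc'.2] at h2
      omega
  rw [Finset.disjoint_left]
  intro y hy hy'
  obtain ⟨k, hk⟩ := mem_descendants.1 hy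
  obtain ⟨k', hk'⟩ := mem_descendants.1 hy'
  rcases le_total k k' with h | h
  · obtain ⟨j, rfl⟩ := Nat.exists_eq_add_of_le h
    rw [add_comm, Function.iterate_add_apply, hk] at hk'
    exact key hc hc' hne j hk'
  · obtain ⟨j, rfl⟩ := Nat.exists_eq_add_of_le h
    rw [add_comm, Function.iterate_add_apply, hk'] at hk
    exact key hc' hc hne.symm j hk

theorem sum_descendants (hP : IsParentMap G w r P) (hw : ∀ e ∈ G.edgeSet, 0 < w e)
    (f : V → ℕ) (u : V) :
    ∑ y ∈ descendants P u, f y = f u + ∑ c ∈ childrenOf r P u, ∑ y ∈ descendants P c, f y := by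
  rw [hP.descendants_eq u, Finset.sum_insert, Finset.sum_biUnion]
  · intro c hc c' hc' hne
    exact hP.disjoint_descendants hw hc hc' hne
  · simp only [Finset.mem_biUnion, not_exists, not_and]
    intro c hc hu
    have h1 := hP.dist_le_of_mem_descendants hu
    rw [mem_childrenOf] at hc
    have h2 := hP.dist_parent_lt hw hc.1
    rw [hc.2] at h2
    omega

theorem descendants_root (hP : IsParentMap G w r P) (hw : ∀ e ∈ G.edgeSet, 0 < w e) :
    descendants P r = Finset.univ :=
  Finset.eq_univ_of_forall (hP.mem_descendants_root hw)

/-! ### The parent tree -/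

theorem parentTree_spanningCoe_isTree (hP : IsParentMap G w r P)
    (hw : ∀ e ∈ G.edgeSet, 0 < w e) : (parentTree hP.adj).spanningCoe.IsTree := by
  have hc := hP.parentTree_spanningCoe_connected hw
  rw [SimpleGraph.isTree_iff_connected_and_card]
  -- Connectivity gives one inequality. For the other, each edge is `s(u, P u)` with `u ≠ r`, so
  -- there are at most `|V| - 1` edges.
  refine ⟨hc, le_antisymm ?_ hc.card_vert_le_card_edgeSet_add_one⟩
  have hsub : (parentTree hP.adj).spanningCoe.edgeSet ⊆
      (((Finset.univ.erase r).image fun u => s(u, P u) : Finset (Sym2 V)) : Set (Sym2 V)) := by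
    intro e
    induction e using Sym2.ind with
    | _ u v =>
      intro h
      simp only [Finset.coe_image, Set.mem_image, Finset.mem_coe, Finset.mem_erase,
        Finset.mem_univ, and_true]
      rcases h with ⟨h, h'⟩ | ⟨h, h'⟩
      · exact ⟨u, h, congrArg (fun z => s(u, z)) h'⟩
      · exact ⟨v, h, (congrArg (fun z => s(v, z)) h').trans Sym2.eq_swap⟩
  have h1 := Set.ncard_le_ncard hsub (Finset.finite_toSet _)
  rw [Set.ncard_coe_finset] at h1
  have h2 := Finset.card_image_le (s := Finset.univ.erase r) (f := fun u => s(u, P u))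
  rw [Finset.card_erase_of_mem (Finset.mem_univ r), Finset.card_univ] at h2
  have h3 : 0 < Fintype.card V := Fintype.card_pos_iff.2 ⟨r⟩
  rw [Nat.card_eq_fintype_card (α := V)]
  change Set.ncard _ + 1 ≤ _
  omega

theorem isShortestPathTree (hP : IsParentMap G w r P) (hw : ∀ e ∈ G.edgeSet, 0 < w e) :
    IsShortestPathTree G w r (parentTree hP.adj) := by
  have hs : (parentTree hP.adj).IsSpanning := fun v => Set.mem_univ v
  refine ⟨hs, ?_, fun u => le_antisymm ?_ ?_⟩
  · exact ((parentTree hP.adj).spanningCoeEquivCoeOfSpanning hs).isTree_iff.1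
      (hP.parentTree_spanningCoe_isTree hw)
  · obtain ⟨p, hp⟩ := hP.exists_walk_root hw u
    rw [wdist_comm]
    exact (wdist_le_walkWeight p).trans hp
  · exact wdist_anti (SimpleGraph.Subgraph.spanningCoe_le _)
      (hP.parentTree_spanningCoe_connected hw r u)

/-! ### Routing costs in the parent tree -/

/-- Crossing a tree edge changes the sum of the separating weights by at most the weight of that
edge; induction along the walk does the rest. -/
theorem sum_sepWeight_le_walkWeight (hP : IsParentMap G w r P) {u v : V}
    (p : (parentTree hP.adj).spanningCoe.Walk u v) :
    ∑ x, sepWeight w P u v x ≤ walkWeight w p := by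
  have step : ∀ c z : V, (∑ x, sepWeight w P c z x ≤ w s(c, P c) + ∑ x, sepWeight w P (P c) z x) ∧
      (∑ x, sepWeight w P (P c) z x ≤ w s(c, P c) + ∑ x, sepWeight w P c z x) := by
    intro c z
    have hsum : w s(c, P c) = ∑ x, if x = c then w s(c, P c) else 0 := by simp
    rw [hsum, ← Finset.sum_add_distrib, ← Finset.sum_add_distrib]
    constructor <;> refine Finset.sum_le_sum fun x _ => ?_ <;> unfold sepWeight <;>
    · by_cases hx : x = c
      · subst hx
        rw [if_pos rfl]
        split_ifs <;> omega
      · simp only [mem_descendants_iff_parent hx, if_neg hx, zero_add, le_refl]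
  induction p with
  | nil => simp [sepWeight]
  | @cons a b z h p ih =>
    rw [walkWeight_cons]
    rcases h with ⟨-, rfl⟩ | ⟨-, rfl⟩
    · exact (step a z).1.trans (by omega)
    · rw [Sym2.eq_swap]
      exact (step b z).2.trans (by omega)

/-- Induction on the sum of the two depths: the endpoint farther from `r` moves to its parent. The
edge crossed separated the endpoints before and no longer does, so exactly its weight is paid. -/
theorem wdist_parentTree_le_sum_sepWeight (hP : IsParentMap G w r P)
    (hw : ∀ e ∈ G.edgeSet, 0 < w e) (u v : V) :
    wdist (parentTree hP.adj).spanningCoe w u v ≤ ∑ x, sepWeight w P u v x := by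
  have hconn := hP.parentTree_spanningCoe_connected hw
  induction hd : wdist G w r u + wdist G w r v using Nat.strong_induction_on
    generalizing u v with
  | _ d ih =>
    have key : ∀ a b : V, wdist G w r a + wdist G w r b = d → a ≠ r → a ≠ b →
        wdist G w r b ≤ wdist G w r a →
        wdist (parentTree hP.adj).spanningCoe w a b ≤ ∑ x, sepWeight w P a b x := by
      intro a b hd ha hab hle
      have h1 := hP.dist_parent_lt hw ha
      have h2 := ih _ (by omega) (P a) b rfl
      have h3 := wdist_le_wdist_add_weight (w := w) hconn b (hP.parentTree_adj_parent ha)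
      rw [wdist_comm b a, wdist_comm b (P a)] at h3
      refine h3.trans ((Nat.add_le_add_right h2 _).trans (le_of_eq ?_))
      have hsum : w s(a, P a) = ∑ x, if x = a then w s(a, P a) else 0 := by simp
      rw [hsum, ← Finset.sum_add_distrib]
      refine Finset.sum_congr rfl fun x _ => ?_
      unfold sepWeight
      by_cases hx : x = a
      · subst hx
        -- A proper descendant is strictly farther from `r`, whereas `b` is at most as far as `a`.
        have hb : b ∉ descendants P x := by
          intro hb
          rw [mem_descendants_iff_parent hab] at hb
          by_cases hbr : b = r
          · subst hbr
            rw [hP.root] at hb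
            have h4 := hP.dist_le_of_mem_descendants hb
            rw [wdist_self] at h4
            omega
          · have h4 := hP.dist_le_of_mem_descendants hb
            have h5 := hP.dist_parent_lt hw hbr
            omega
        simp [hb, hP.parent_notMem_descendants hw ha, self_mem_descendants]
      · simp only [mem_descendants_iff_parent hx, if_neg hx, add_zero]
    have hzero : ∀ a : V, wdist G w r a = 0 → a = r := by
      intro a ha
      by_contra har
      have := hP.dist_parent_lt hw har
      omega
    by_cases huv : u = v
    · subst huv
      simp [wdist_self]
    rcases le_total (wdist G w r v) (wdist G w r u) with hle | hle
    · refine key u v hd (fun hu => huv ?_) huv hle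
      subst hu
      rw [wdist_self] at hle
      exact (hzero v (by omega)).symm
    · have := key v u (by omega) (fun hv => huv ?_) (Ne.symm huv) hle
      · rw [wdist_comm]
        refine this.trans (le_of_eq (Finset.sum_congr rfl fun x _ => ?_))
        unfold sepWeight
        simp only [iff_comm]
      · subst hv
        rw [wdist_self] at hle
        exact hzero u (by omega)

theorem wdist_parentTree (hP : IsParentMap G w r P) (hw : ∀ e ∈ G.edgeSet, 0 < w e) (u v : V) :
    wdist (parentTree hP.adj).spanningCoe w u v = ∑ x, sepWeight w P u v x := by
  refine le_antisymm (hP.wdist_parentTree_le_sum_sepWeight hw u v) ?_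
  obtain ⟨p, hp⟩ := exists_walkWeight_eq_wdist (w := w)
    (hP.parentTree_spanningCoe_connected hw u v)
  exact hp ▸ hP.sum_sepWeight_le_walkWeight p

end IsParentMap

/-- Number of vertices of `S` in the subtree below `u`. -/
def subtreeCount (S : Finset V) (P : V → V) (u : V) : ℕ :=
  ∑ y ∈ descendants P u, if y ∈ S then 1 else 0

/-- Half of the contribution of the edge between `x` and its parent to the routing cost. -/
def edgeCost (w : Sym2 V → ℕ) (S : Finset V) (P : V → V) (x : V) : ℕ :=
  w s(x, P x) * subtreeCount S P x * (S.card - subtreeCount S P x)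

/-- Half of the routing cost that is due to the edges in the subtree below `u`. -/
def subtreeRoutingCost (w : Sym2 V → ℕ) (S : Finset V) (r : V) (P : V → V) (u : V) : ℕ :=
  ∑ c ∈ childrenOf r P u, ∑ y ∈ descendants P c, edgeCost w S P y

theorem subtreeCount_eq_card (S : Finset V) (P : V → V) (u : V) :
    subtreeCount S P u = (S.filter (· ∈ descendants P u)).card := by
  rw [subtreeCount, ← Finset.sum_filter, Finset.card_eq_sum_ones]
  congr 1
  ext y
  simp [and_comm]

theorem subtreeCount_le (S : Finset V) (P : V → V) (u : V) : subtreeCount S P u ≤ S.card := by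
  rw [subtreeCount_eq_card]
  exact Finset.card_filter_le _ _

/-- The edge above `x` separates the part `A` of `S` below `x` from the rest `B`; each of the
`|A||B|` pairs is counted in both orders. -/
theorem sum_sum_sepWeight (w : Sym2 V → ℕ) (S : Finset V) (P : V → V) (x : V) :
    ∑ u ∈ S, ∑ v ∈ S, sepWeight w P u v x = 2 * edgeCost w S P x := by
  set A := S.filter (· ∈ descendants P x) with hA
  set B := S.filter (· ∉ descendants P x) with hB
  have hcard : A.card + B.card = S.card := Finset.card_filter_add_card_filter_not _
  have hx : subtreeCount S P x = A.card := subtreeCount_eq_card S P x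
  have split : ∀ f : V → ℕ, ∑ u ∈ S, f u = ∑ u ∈ A, f u + ∑ u ∈ B, f u := fun f =>
    (Finset.sum_filter_add_sum_filter_not S _ f).symm
  have hAmem : ∀ u ∈ A, u ∈ descendants P x := fun u hu => (Finset.mem_filter.1 hu).2
  have hBmem : ∀ u ∈ B, u ∉ descendants P x := fun u hu => (Finset.mem_filter.1 hu).2
  have inA : ∀ u ∈ A, ∑ v ∈ S, sepWeight w P u v x = B.card * w s(x, P x) := by
    intro u hu
    rw [split, Finset.sum_eq_zero, Finset.sum_congr rfl (g := fun _ => w s(x, P x))]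
    · simp
    · intro v hv
      simp [sepWeight, hAmem u hu, hBmem v hv]
    · intro v hv
      simp [sepWeight, hAmem u hu, hAmem v hv]
  have inB : ∀ u ∈ B, ∑ v ∈ S, sepWeight w P u v x = A.card * w s(x, P x) := by
    intro u hu
    rw [split, Finset.sum_congr rfl (g := fun _ => w s(x, P x)), Finset.sum_eq_zero (s := B)]
    · simp
    · intro v hv
      simp [sepWeight, hBmem u hu, hBmem v hv]
    · intro v hv
      simp [sepWeight, hBmem u hu, hAmem v hv]
  rw [split, Finset.sum_congr rfl inA, Finset.sum_congr rfl inB]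
  simp only [Finset.sum_const, smul_eq_mul, edgeCost, hx]
  rw [show S.card - A.card = B.card by omega]
  ring

namespace IsParentMap

variable {G : SimpleGraph V} {w : Sym2 V → ℕ} {r : V} {P : V → V}

theorem subtreeCount_rec (hP : IsParentMap G w r P) (hw : ∀ e ∈ G.edgeSet, 0 < w e)
    (S : Finset V) (u : V) :
    subtreeCount S P u = (if u ∈ S then 1 else 0) + ∑ c ∈ childrenOf r P u, subtreeCount S P c :=
  hP.sum_descendants hw _ u

theorem subtreeCount_root (hP : IsParentMap G w r P) (hw : ∀ e ∈ G.edgeSet, 0 < w e)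
    (S : Finset V) : subtreeCount S P r = S.card := by
  simp [subtreeCount, hP.descendants_root hw]

theorem subtreeRoutingCost_rec (hP : IsParentMap G w r P) (hw : ∀ e ∈ G.edgeSet, 0 < w e)
    (S : Finset V) (u : V) :
    subtreeRoutingCost w S r P u =
      ∑ c ∈ childrenOf r P u, (subtreeRoutingCost w S r P c +
        w s(u, c) * subtreeCount S P c * (S.card - subtreeCount S P c)) := by
  refine Finset.sum_congr rfl fun c hc => ?_
  rw [hP.sum_descendants hw, add_comm, edgeCost, (mem_childrenOf.1 hc).2, Sym2.eq_swap]
  rfl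

theorem subtreeRoutingCost_root (hP : IsParentMap G w r P) (hw : ∀ e ∈ G.edgeSet, 0 < w e)
    (S : Finset V) : subtreeRoutingCost w S r P r = ∑ x, edgeCost w S P x := by
  have h := hP.sum_descendants hw (edgeCost w S P) r
  rw [hP.descendants_root hw] at h
  -- There is no edge above the root; its formal summand vanishes because of the factor `|S| - |S|`.
  rw [h, edgeCost, hP.subtreeCount_root hw]
  simp [subtreeRoutingCost]

/-- Needed for the message size: no intermediate cost is larger than the final one. -/
theorem subtreeRoutingCost_le_root (hP : IsParentMap G w r P) (hw : ∀ e ∈ G.edgeSet, 0 < w e)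
    (S : Finset V) (u : V) : subtreeRoutingCost w S r P u ≤ subtreeRoutingCost w S r P r := by
  rw [hP.subtreeRoutingCost_root hw]
  have h := hP.sum_descendants hw (edgeCost w S P) u
  have h2 : ∑ y ∈ descendants P u, edgeCost w S P y ≤ ∑ x, edgeCost w S P x :=
    Finset.sum_le_sum_of_subset (Finset.subset_univ _)
  rw [subtreeRoutingCost]
  omega

theorem two_mul_subtreeRoutingCost_root (hP : IsParentMap G w r P)
    (hw : ∀ e ∈ G.edgeSet, 0 < w e) (S : Finset V) :
    2 * subtreeRoutingCost w S r P r = routingCost w S (parentTree hP.adj) := by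
  rw [hP.subtreeRoutingCost_root hw, routingCost, Finset.mul_sum]
  simp only [hP.wdist_parentTree hw]
  simp_rw [← sum_sum_sepWeight]
  rw [Finset.sum_comm]
  refine Finset.sum_congr rfl fun u _ => ?_
  rw [Finset.sum_comm]

end IsParentMap

end ParentMaps

/-! ## Shortest-path trees approximate minimum routing cost trees -/

section Approximation

variable {V : Type} {G : SimpleGraph V} {w : Sym2 V → ℕ}

theorem IsShortestPathTree.spanningCoe_connected {r : V} {T : G.Subgraph}
    (h : IsShortestPathTree G w r T) : T.spanningCoe.Connected :=
  (T.spanningCoeEquivCoeOfSpanning h.1).connected_iff.2 h.2.1.connected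

theorem IsShortestPathTree.spansAsTree {r : V} {T : G.Subgraph}
    (h : IsShortestPathTree G w r T) (S : Finset V) : SpansAsTree G S T :=
  ⟨h.2.1, fun v _ => h.1 v⟩

theorem IsShortestPathTree.wdist_le {r : V} {T : G.Subgraph} (h : IsShortestPathTree G w r T)
    (u v : V) : wdist T.spanningCoe w u v ≤ wdist G w r u + wdist G w r v := by
  have := wdist_triangle (w := w) h.spanningCoe_connected u r v
  rwa [wdist_comm u r, h.2.2, h.2.2] at this

theorem IsShortestPathTree.routingCost_le {r : V} {T : G.Subgraph}
    (h : IsShortestPathTree G w r T) (S : Finset V) :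
    routingCost w S T ≤ 2 * S.card * ∑ u ∈ S, wdist G w r u := by
  calc routingCost w S T ≤ ∑ u ∈ S, ∑ v ∈ S, (wdist G w r u + wdist G w r v) :=
        Finset.sum_le_sum fun u _ => Finset.sum_le_sum fun v _ => h.wdist_le u v
    _ = 2 * S.card * ∑ u ∈ S, wdist G w r u := by
        simp only [Finset.sum_add_distrib, Finset.sum_const, smul_eq_mul, ← Finset.mul_sum]
        ring

theorem SpansAsTree.wdist_le {S : Finset V} {T : G.Subgraph} (h : SpansAsTree G S T) {u v : V}
    (hu : u ∈ S) (hv : v ∈ S) : wdist G w u v ≤ wdist T.spanningCoe w u v := by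
  refine wdist_anti (SimpleGraph.Subgraph.spanningCoe_le _) ?_
  have := h.1.connected ⟨u, h.2 hu⟩ ⟨v, h.2 hv⟩
  exact this.map T.coeEmbeddingSpanningCoe.toHom

/-- An averaging argument, multiplied by `|S|` to stay within the natural numbers: the minimum is at
most the average over all roots in `S`, and the double sum of distances in `G` is at most the
optimal routing cost. -/
theorem isMulApprox_of_forall_le {S : Finset V} (T : V → G.Subgraph)
    (hT : ∀ r ∈ S, IsShortestPathTree G w r (T r)) {best : V} (hbest : best ∈ S)
    (hle : ∀ r ∈ S, routingCost w S (T best) ≤ routingCost w S (T r)) :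
    IsMulApprox 2 (optRoutingCost G w S) (routingCost w S (T best)) := by
  have hmem : routingCost w S (T best) ∈
      {c | ∃ T : G.Subgraph, SpansAsTree G S T ∧ c = routingCost w S T} :=
    ⟨_, (hT best hbest).spansAsTree S, rfl⟩
  refine ⟨Nat.sInf_le hmem, ?_⟩
  obtain ⟨T₀, hT₀, hopt⟩ := Nat.sInf_mem ⟨_, hmem⟩
  change optRoutingCost G w S = _ at hopt
  rw [hopt]
  have h1 : S.card * routingCost w S (T best) ≤ S.card * (2 * routingCost w S T₀) := by
    calc S.card * routingCost w S (T best) = ∑ r ∈ S, routingCost w S (T best) := by simp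
      _ ≤ ∑ r ∈ S, 2 * S.card * ∑ u ∈ S, wdist G w r u :=
          Finset.sum_le_sum fun r hr => (hle r hr).trans ((hT r hr).routingCost_le S)
      _ = 2 * S.card * ∑ r ∈ S, ∑ u ∈ S, wdist G w r u := by rw [Finset.mul_sum]
      _ ≤ 2 * S.card * routingCost w S T₀ := Nat.mul_le_mul_left _ <|
          Finset.sum_le_sum fun r hr => Finset.sum_le_sum fun u hu => hT₀.wdist_le hr hu
      _ = S.card * (2 * routingCost w S T₀) := by ring
  exact Nat.le_of_mul_le_mul_left h1 (Finset.card_pos.2 ⟨best, hbest⟩)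

end Approximation

/-! ## Lexicographic minima -/

section LexMin

/-- The lexicographically smallest element of a set of pairs, if there is one. -/
def lexMin (K : Set (ℕ × ℕ)) : Option (ℕ × ℕ) :=
  if K.Nonempty then
    some (sInf (Prod.fst '' K), sInf {b | (sInf (Prod.fst '' K), b) ∈ K})
  else none

theorem lexMin_mem {K : Set (ℕ × ℕ)} {p : ℕ × ℕ} (h : lexMin K = some p) : p ∈ K := by
  unfold lexMin at h
  split_ifs at h with hK
  obtain ⟨q, hq, hq'⟩ := Nat.sInf_mem (hK.image Prod.fst)
  cases h
  exact Nat.sInf_mem (s := {b | (sInf (Prod.fst '' K), b) ∈ K}) ⟨q.2, by rw [← hq']; exact hq⟩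

theorem lexMin_le {K : Set (ℕ × ℕ)} {p q : ℕ × ℕ} (h : lexMin K = some p) (hq : q ∈ K) :
    p.1 < q.1 ∨ p.1 = q.1 ∧ p.2 ≤ q.2 := by
  unfold lexMin at h
  split_ifs at h with hK
  cases h
  have h1 : sInf (Prod.fst '' K) ≤ q.1 := Nat.sInf_le ⟨q, hq, rfl⟩
  rcases h1.lt_or_eq with h2 | h2
  · exact Or.inl h2
  · exact Or.inr ⟨h2, Nat.sInf_le (by rw [Set.mem_ofPred_eq, h2]; exact hq)⟩

theorem exists_lexMin {K : Set (ℕ × ℕ)} (h : K.Nonempty) : ∃ p, lexMin K = some p := by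
  unfold lexMin
  rw [if_pos h]
  exact ⟨_, rfl⟩

theorem lexMin_eq_some {K : Set (ℕ × ℕ)} {p : ℕ × ℕ} (hp : p ∈ K)
    (hle : ∀ q ∈ K, p.1 < q.1 ∨ p.1 = q.1 ∧ p.2 ≤ q.2) : lexMin K = some p := by
  obtain ⟨q, hq⟩ := exists_lexMin ⟨p, hp⟩
  have h1 := lexMin_le hq hp
  have h2 := hle q (lexMin_mem hq)
  rw [hq]
  congr 1
  ext <;> omega

end LexMin

/-! ## Messages -/

/-- The contents of a message.  `token` is a pair (distance, source), `report` is a triple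
(root, subtree size, subtree cost) and `best` is a pair (cost, root). -/
structure Packet where
  token : Option (ℕ × ℕ)
  count : ℕ
  start : Option ℕ
  report : Option (ℕ × ℕ × ℕ)
  best : Option (ℕ × ℕ)

namespace Packet

/-- The fields of a packet as a tuple. -/
def toTuple (m : Packet) :
    Option (ℕ × ℕ) × ℕ × Option ℕ × Option (ℕ × ℕ × ℕ) × Option (ℕ × ℕ) :=
  (m.token, m.count, m.start, m.report, m.best)

/-- The packet with given fields. -/
def ofTuple (x : Option (ℕ × ℕ) × ℕ × Option ℕ × Option (ℕ × ℕ × ℕ) × Option (ℕ × ℕ)) : Packet :=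
  ⟨x.1, x.2.1, x.2.2.1, x.2.2.2.1, x.2.2.2.2⟩

/-- Encoding of a packet as a bit string. -/
def encode (m : Packet) : Message := (Encodable.encode m.toTuple).bits

/-- Decoding of a bit string. -/
def decode (l : Message) : Packet :=
  ((Encodable.decode (Nat.ofDigits 2 (l.map fun b => cond b 1 0))).map ofTuple).getD
    ⟨none, 0, none, none, none⟩

theorem decode_encode (m : Packet) : decode m.encode = m := by
  rw [decode, encode, ← Nat.digits_two_eq_bits, Nat.ofDigits_digits, Encodable.encodek]
  rfl

/-- All numbers in the packet have at most `k` binary digits. -/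
structure Fits (m : Packet) (k : ℕ) : Prop where
  token : ∀ p, m.token = some p → p.1 < 2 ^ k ∧ p.2 < 2 ^ k
  count : m.count < 2 ^ k
  start : ∀ b, m.start = some b → b < 2 ^ k
  report : ∀ p, m.report = some p → p.1 < 2 ^ k ∧ p.2.1 < 2 ^ k ∧ p.2.2 < 2 ^ k
  best : ∀ p, m.best = some p → p.1 < 2 ^ k ∧ p.2 < 2 ^ k

theorem pair_lt_two_pow {a b k : ℕ} (ha : a < 2 ^ k) (hb : b < 2 ^ k) :
    Nat.pair a b < 2 ^ (2 * k) := by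
  refine (Nat.pair_lt_max_add_one_sq a b).trans_le ?_
  rw [mul_comm, pow_mul]
  exact Nat.pow_le_pow_left (max_lt ha hb) 2

theorem encode_option_lt_two_pow {α : Type} [Encodable α] {x : Option α} {k : ℕ}
    (h : ∀ a, x = some a → Encodable.encode a < 2 ^ k) : Encodable.encode x < 2 ^ (k + 1) := by
  cases x with
  | none => simp
  | some a =>
    have := h a rfl
    rw [Encodable.encode_some, pow_succ, Nat.succ_eq_add_one]
    omega

/-- Pairing doubles the number of bits and `Option` adds one. The report takes `4 * k + 1` bits and
lies within four nested pairs, whence `16 * (4 * k + 1)`. -/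
theorem Fits.length_encode_le {m : Packet} {k : ℕ} (h : m.Fits k) :
    m.encode.length ≤ 64 * k + 16 := by
  have mono : ∀ {x i j : ℕ}, x < 2 ^ i → i ≤ j → x < 2 ^ j := fun hx hij =>
    hx.trans_le (Nat.pow_le_pow_right (by norm_num) hij)
  have pairs : ∀ {x : Option (ℕ × ℕ)}, (∀ p, x = some p → p.1 < 2 ^ k ∧ p.2 < 2 ^ k) →
      Encodable.encode x < 2 ^ (2 * k + 1) := fun hx =>
    encode_option_lt_two_pow fun p hp => by
      obtain ⟨a, b⟩ := p
      simpa using pair_lt_two_pow (hx _ hp).1 (hx _ hp).2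
  have h1 := pairs h.token
  have h2 := h.count
  have h3 : Encodable.encode m.start < 2 ^ (k + 1) :=
    encode_option_lt_two_pow fun b hb => by simpa using h.start b hb
  have h4 : Encodable.encode m.report < 2 ^ (4 * k + 1) :=
    encode_option_lt_two_pow fun p hp => by
      obtain ⟨a, b, c⟩ := p
      obtain ⟨ha, hb, hc⟩ := h.report _ hp
      have := pair_lt_two_pow (mono ha (j := 2 * k) (by omega)) (pair_lt_two_pow hb hc)
      simpa using mono this (by omega)
  have h5 := pairs h.best
  have h6 := pair_lt_two_pow h4 (mono h5 (by omega))
  have h7 := pair_lt_two_pow (mono h3 (by omega)) h6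
  have h8 := pair_lt_two_pow (mono h2 (by omega)) h7
  have h9 := pair_lt_two_pow (mono h1 (by omega)) h8
  rw [encode, Nat.size_eq_bits_len, Nat.size_le]
  have h10 := mono h9 (j := 64 * k + 16) (by omega)
  simpa [toTuple] using h10

end Packet

/-! ## The algorithm -/

/-- The state of a node: its input, the number of elapsed rounds, the set of all packets received
so far together with the identifiers of their senders, and the common starting time of the second
stage, once known. -/
structure NodeState where
  input : LocalInput
  time : ℕ
  inbox : Set (ℕ × Packet)
  started : Option ℕ

namespace NodeState

variable (s : NodeState)

/-- The upper bounds on the distance to the source `j`, each with the identifier of the neighbor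
that it comes from (or `0`, if the node is the source itself). -/
def offers (j : ℕ) : Set (ℕ × ℕ) :=
  {p | (s.input.inS ∧ j = s.input.ident ∧ p = (0, 0)) ∨
    ∃ w d m, (p.2, w) ∈ s.input.links ∧ (p.2, m) ∈ s.inbox ∧ m.token = some (d, j) ∧
      p.1 = d + w}

/-- The best offer for the source `j`. -/
def route (j : ℕ) : Option (ℕ × ℕ) := lexMin (s.offers j)

/-- The sources that the node has heard of. -/
def sources : Set ℕ := {j | ∃ p, s.route j = some p}

/-- The number of sources that, as far as the node knows, precede the source `j` at
distance `d`. -/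
def rank (d j : ℕ) : ℕ := Set.ncard {i | ∃ p, s.route i = some p ∧ (p.1 < d ∨ p.1 = d ∧ i < j)}

/-- The distance that is announced in the current round. -/
def token : Option (ℕ × ℕ) :=
  lexMin {q | ∃ p, s.route q.2 = some (q.1, p) ∧ q.1 + s.rank q.1 q.2 = s.time}

/-- The node knows its final distances from all sources. -/
def complete : Prop :=
  s.sources.ncard = s.input.sizeS ∧
    ∀ j d p, s.route j = some (d, p) → d + s.rank d j ≤ s.time

/-- The smallest source. -/
def leader : ℕ := sInf s.sources

/-- The number of complete nodes in the subtree of the leader's tree, as far as known. -/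
def counted : ℕ :=
  if s.complete then
    1 + ∑ l ∈ s.input.links, sSup {c | ∃ m, (l.1, m) ∈ s.inbox ∧ m.count = c}
  else 0

/-- The node is the leader and knows that all nodes are complete. -/
def ready : Prop := s.complete ∧ s.leader = s.input.ident ∧ s.counted = s.input.numNodes

/-- The starting times of the second stage that the node has heard of. -/
def startTimes : Set ℕ :=
  {b | s.started = some b ∨ (∃ i m, (i, m) ∈ s.inbox ∧ m.start = some b) ∨
    (s.ready ∧ b = s.time)}

/-- The starting time of the second stage. -/
def startTime : Option ℕ := if s.startTimes.Nonempty then some (sInf s.startTimes) else none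

/-- The subtree size reported by the neighbor `i` for the root `j`. -/
def childSize (j i : ℕ) : ℕ := sInf {z | ∃ m c, (i, m) ∈ s.inbox ∧ m.report = some (j, z, c)}

/-- The subtree cost reported by the neighbor `i` for the root `j`. -/
def childCost (j i : ℕ) : ℕ := sInf {c | ∃ m z, (i, m) ∈ s.inbox ∧ m.report = some (j, z, c)}

/-- The number of nodes of `S` in the subtree of the tree with root `j`. -/
def size (j : ℕ) : ℕ :=
  (if s.input.inS then 1 else 0) + ∑ l ∈ s.input.links, s.childSize j l.1

/-- The routing cost of the subtree of the tree with root `j`. -/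
def cost (j : ℕ) : ℕ :=
  ∑ l ∈ s.input.links, (s.childCost j l.1 +
    l.2 * s.childSize j l.1 * (s.input.sizeS - s.childSize j l.1))

/-- The roots for which a report to the parent `i` is due in the current round. -/
def due (i : ℕ) : Set ℕ :=
  {j | ∃ b d, s.startTime = some b ∧ s.route j = some (d, i) ∧
    s.time + (d + s.rank d j) = 3 * b}

/-- The report that is sent to the neighbor `i` in the current round. -/
def report (i : ℕ) : Option (ℕ × ℕ × ℕ) :=
  if (s.due i).Nonempty then
    some (sInf (s.due i), s.size (sInf (s.due i)), s.cost (sInf (s.due i)))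
  else none

/-- The roots that the node knows the costs of. -/
def candidates : Set (ℕ × ℕ) :=
  {p | (∃ i m, (i, m) ∈ s.inbox ∧ m.best = some p) ∨
    (s.input.inS ∧ p = (s.cost s.input.ident, s.input.ident) ∧
      ∃ b, s.startTime = some b ∧ 3 * b ≤ s.time)}

/-- The cheapest root that the node knows. -/
def best : Option (ℕ × ℕ) := lexMin s.candidates

/-- The identifier of the parent in the tree with root `j`. -/
def parent (j : ℕ) : Option ℕ := (s.route j).bind fun p => if p.2 = 0 then none else some p.2

/-- The packet that is sent to the neighbor `i` in the current round. -/
def packet (i : ℕ) : Packet where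
  token := s.token
  count := if s.complete ∧ s.parent s.leader = some i then s.counted else 0
  start := s.startTime
  report := s.report i
  best := s.best

/-- The result of the node. -/
def result : Result where
  parent := s.parent
  dist j := ((s.route j).getD (0, 0)).1
  subtreeSize := s.size
  subtreeCost := s.cost
  best := (s.best.getD (0, 0)).2

end NodeState

/-- The algorithm.  In the first stage, every node announces its distances from the sources in
the order of their distances, and the leader counts the nodes that know all their distances.  The
time at which it has counted all of them is the starting time of the second stage.  In that stage,
the subtree costs travel towards the roots in the reverse order, after which the cheapest root is
determined. -/
def mrct : Algorithm Result where
  State := NodeState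
  init I := ⟨I, 0, ∅, none⟩
  send s i := some (s.packet i).encode
  step s rcv :=
    { input := s.input
      time := s.time + 1
      inbox := s.inbox ∪ {x | ∃ l, rcv x.1 = some l ∧ x.2 = Packet.decode l}
      started := s.startTime }
  output s := if ∃ b, s.startTime = some b ∧ 4 * b ≤ s.time then some s.result else none

/-! ## Executions -/

namespace Network

section Setup

variable {V : Type} [Fintype V] (N : Network V) (S : Finset V)

/-- The state of node `u` after `t` rounds of the algorithm. -/
def state (t : ℕ) (u : V) : NodeState := N.run S mrct t u

/-- Weighted distance in the network. -/
def dist (r u : V) : ℕ := wdist N.graph N.weight r u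

/-- No message needs more rounds than the weight of the edge it travels through. -/
def LatencyLeWeight : Prop :=
  ∀ ⦃u v⦄, N.graph.Adj u v → N.latency s(u, v) ≤ N.weight s(u, v)

theorem latency_pos_of_adj {u v : V} (h : N.graph.Adj u v) : 0 < N.latency s(u, v) :=
  N.latency_pos _ h

theorem weight_pos_of_adj {u v : V} (h : N.graph.Adj u v) : 0 < N.weight s(u, v) :=
  N.weight_pos _ h

theorem neighbor_eq_some {u v : V} {i : ℕ} :
    N.neighbor u i = some v ↔ N.graph.Adj u v ∧ N.ident v = i := by
  unfold neighbor
  constructor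
  · intro h
    split_ifs at h with hex
    cases h
    exact hex.choose_spec
  · intro h
    have hex : ∃ v, N.graph.Adj u v ∧ N.ident v = i := ⟨v, h⟩
    rw [dif_pos hex]
    exact congrArg some (N.ident_injective (hex.choose_spec.2.trans h.2.symm))

theorem state_zero (u : V) : N.state S 0 u = ⟨N.localInput S u, 0, ∅, none⟩ := by
  unfold state
  rw [run]
  rfl

theorem state_succ (t : ℕ) (u : V) :
    N.state S (t + 1) u =
      { input := (N.state S t u).input
        time := (N.state S t u).time + 1
        inbox := (N.state S t u).inbox ∪ {x | ∃ v, N.graph.Adj u v ∧ N.ident v = x.1 ∧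
          N.latency s(u, v) ≤ t + 1 ∧
          x.2 = (N.state S (t + 1 - N.latency s(u, v)) v).packet (N.ident u)}
        started := (N.state S t u).startTime } := by
  have key : N.state S (t + 1) u = mrct.step (N.state S t u) (fun i =>
      (N.neighbor u i).bind fun v =>
        if _h : 0 < N.latency s(u, v) ∧ N.latency s(u, v) ≤ t + 1 then
          mrct.send (N.state S (t + 1 - N.latency s(u, v)) v) (N.ident u)
        else none) := by
    unfold state
    rw [run]
  rw [key]
  change NodeState.mk _ _ _ _ = NodeState.mk _ _ _ _
  congr 2
  ext ⟨i, m⟩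
  simp only [Set.mem_ofPred_eq, Option.bind_eq_some_iff, neighbor_eq_some]
  constructor
  · rintro ⟨l, ⟨v, ⟨hadj, hi⟩, hl⟩, rfl⟩
    split_ifs at hl with h
    refine ⟨v, hadj, hi, h.2, ?_⟩
    cases hl
    exact Packet.decode_encode _
  · rintro ⟨v, hadj, hi, hlat, rfl⟩
    refine ⟨_, ⟨v, ⟨hadj, hi⟩, ?_⟩, (Packet.decode_encode _).symm⟩
    rw [dif_pos ⟨N.latency_pos_of_adj hadj, hlat⟩]
    rfl

@[simp]
theorem state_input (t : ℕ) (u : V) : (N.state S t u).input = N.localInput S u := by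
  induction t with
  | zero => rw [state_zero]
  | succ t ih => rw [state_succ]; exact ih

@[simp]
theorem state_time (t : ℕ) (u : V) : (N.state S t u).time = t := by
  induction t with
  | zero => rw [state_zero]
  | succ t ih => rw [state_succ]; exact congrArg (· + 1) ih

theorem state_started_succ (t : ℕ) (u : V) :
    (N.state S (t + 1) u).started = (N.state S t u).startTime := by
  rw [state_succ]

theorem state_started_zero (u : V) : (N.state S 0 u).started = none := by
  rw [state_zero]

/-- Inboxes only grow, so the recursion unrolls into a statement about all earlier sending times.
Arguments about messages then become strong inductions on time, as latencies are positive. -/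
theorem mem_inbox {t : ℕ} {u : V} {i : ℕ} {m : Packet} :
    (i, m) ∈ (N.state S t u).inbox ↔ ∃ v s, N.graph.Adj u v ∧ N.ident v = i ∧
      s + N.latency s(u, v) ≤ t ∧ m = (N.state S s v).packet (N.ident u) := by
  induction t with
  | zero =>
    rw [state_zero]
    constructor
    · intro h
      exact absurd h (Set.notMem_empty _)
    · rintro ⟨v, s, hadj, -, hle, -⟩
      have := N.latency_pos_of_adj hadj
      omega
  | succ t ih =>
    rw [state_succ, Set.mem_union, ih]
    constructor
    · rintro (⟨v, s, hadj, hi, hle, hm⟩ | ⟨v, hadj, hi, hle, hm⟩)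
      · exact ⟨v, s, hadj, hi, by omega, hm⟩
      · exact ⟨v, _, hadj, hi, by omega, hm⟩
    · rintro ⟨v, s, hadj, hi, hle, hm⟩
      rcases hle.lt_or_eq with h | h
      · exact Or.inl ⟨v, s, hadj, hi, by omega, hm⟩
      · refine Or.inr ⟨v, hadj, hi, by omega, ?_⟩
        rw [← h, Nat.add_sub_cancel]
        exact hm

theorem mem_inbox_ident {t : ℕ} {u v : V} {m : Packet} (hadj : N.graph.Adj u v) :
    (N.ident v, m) ∈ (N.state S t u).inbox ↔
      ∃ s, s + N.latency s(u, v) ≤ t ∧ m = (N.state S s v).packet (N.ident u) := by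
  rw [mem_inbox]
  constructor
  · rintro ⟨v', s, -, hi, h⟩
    obtain rfl := N.ident_injective hi
    exact ⟨s, h⟩
  · rintro ⟨s, h⟩
    exact ⟨v, s, hadj, rfl, h⟩

theorem mem_links {u : V} {i w : ℕ} :
    (i, w) ∈ (N.localInput S u).links ↔
      ∃ v, N.graph.Adj u v ∧ N.ident v = i ∧ N.weight s(u, v) = w := by
  simp [localInput]

theorem sum_links (u : V) (f : ℕ × ℕ → ℕ) :
    ∑ l ∈ (N.localInput S u).links, f l =
      ∑ v ∈ Finset.univ.filter (N.graph.Adj u), f (N.ident v, N.weight s(u, v)) := by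
  unfold localInput
  refine Finset.sum_image fun a _ b _ h => ?_
  exact N.ident_injective (Prod.mk.inj h).1

/-- The source `r'` precedes the source `r` at the node `u`. -/
def Precedes (u r' r : V) : Prop :=
  N.dist r' u < N.dist r u ∨ N.dist r' u = N.dist r u ∧ N.ident r' < N.ident r

/-- The number of sources that precede `r` at the node `u`. -/
def sourceRank (r u : V) : ℕ := (S.filter fun r' => N.Precedes u r' r).card

/-- The round in which the node `u` announces its distance from `r`. -/
def slot (r u : V) : ℕ := N.dist r u + N.sourceRank S r u

/-- The possible parents of `u` in a shortest-path tree with root `r`. -/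
def parentCandidates (r u : V) : Finset V :=
  Finset.univ.filter fun v => N.graph.Adj u v ∧ N.dist r v + N.weight s(u, v) = N.dist r u

/-- The parent of `u` in the shortest-path tree with root `r`. -/
def parentOf (r u : V) : V :=
  if h : (N.parentCandidates r u).Nonempty then
    (Finset.exists_min_image (N.parentCandidates r u) N.ident h).choose
  else u

/-- The identifier of the parent of `u` in the tree with root `r`, and `0` for the root. -/
def parentIdent (r u : V) : ℕ := if u = r then 0 else N.ident (N.parentOf r u)

theorem mem_parentCandidates {r u v : V} : v ∈ N.parentCandidates r u ↔
    N.graph.Adj u v ∧ N.dist r v + N.weight s(u, v) = N.dist r u := by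
  simp [parentCandidates]

theorem dist_self (u : V) : N.dist u u = 0 := wdist_self u

theorem dist_le_add_weight (r : V) {u v : V} (h : N.graph.Adj u v) :
    N.dist r u ≤ N.dist r v + N.weight s(u, v) :=
  wdist_le_wdist_add_weight N.connected r h

theorem parentCandidates_self (r : V) : N.parentCandidates r r = ∅ := by
  refine Finset.eq_empty_of_forall_notMem fun v hv => ?_
  rw [mem_parentCandidates, dist_self] at hv
  have := N.weight_pos_of_adj hv.1
  omega

theorem parentCandidates_nonempty {r u : V} (h : u ≠ r) : (N.parentCandidates r u).Nonempty := by
  obtain ⟨v, hv⟩ := exists_adj_wdist_add_weight (w := N.weight) N.connected h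
  exact ⟨v, N.mem_parentCandidates.2 hv⟩

theorem parentOf_self (r : V) : N.parentOf r r = r := by
  rw [parentOf, dif_neg]
  simp [parentCandidates_self]

theorem parentOf_spec {r u : V} (h : u ≠ r) : N.parentOf r u ∈ N.parentCandidates r u ∧
    ∀ v ∈ N.parentCandidates r u, N.ident (N.parentOf r u) ≤ N.ident v := by
  rw [parentOf, dif_pos (N.parentCandidates_nonempty h)]
  exact (Finset.exists_min_image _ N.ident (N.parentCandidates_nonempty h)).choose_spec

theorem adj_parentOf {r u : V} (h : u ≠ r) : N.graph.Adj u (N.parentOf r u) :=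
  (N.mem_parentCandidates.1 (N.parentOf_spec h).1).1

theorem dist_parentOf {r u : V} (h : u ≠ r) :
    N.dist r (N.parentOf r u) + N.weight s(u, N.parentOf r u) = N.dist r u :=
  (N.mem_parentCandidates.1 (N.parentOf_spec h).1).2

theorem isParentMap (r : V) : IsParentMap N.graph N.weight r (N.parentOf r) where
  root := N.parentOf_self r
  adj _ h := N.adj_parentOf h
  dist _ h := N.dist_parentOf h

/-- Identifiers are positive, so the mark `0` of the root cannot be mistaken for a parent. -/
theorem parentIdent_eq_ident {r u v : V} :
    N.parentIdent r u = N.ident v ↔ u ≠ r ∧ N.parentOf r u = v := by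
  unfold parentIdent
  have := N.ident_pos v
  split_ifs with h
  · simp [h]
    omega
  · simp [h, N.ident_injective.eq_iff]

theorem dist_le_diam (u v : V) : N.dist u v ≤ N.diam :=
  (Finset.le_sup (f := fun v => wdist N.graph N.weight u v) (Finset.mem_univ v)).trans
    (Finset.le_sup (f := fun u => Finset.univ.sup fun v => wdist N.graph N.weight u v)
      (Finset.mem_univ u))

/-! ### The order of the sources at a node and the announcement schedule -/

variable {S}

theorem Precedes.trans {u r₁ r₂ r₃ : V} (h₁ : N.Precedes u r₁ r₂) (h₂ : N.Precedes u r₂ r₃) :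
    N.Precedes u r₁ r₃ := by
  unfold Precedes at *
  omega

theorem not_precedes_self (u r : V) : ¬ N.Precedes u r r := by
  unfold Precedes
  omega

theorem precedes_or_precedes (u : V) {r r' : V} (h : r ≠ r') :
    N.Precedes u r r' ∨ N.Precedes u r' r := by
  have := N.ident_injective.ne h
  unfold Precedes
  omega

theorem sourceRank_lt {u r r' : V} (hr' : r' ∈ S) (h : N.Precedes u r' r) :
    N.sourceRank S r' u < N.sourceRank S r u := by
  refine Finset.card_lt_card (Finset.ssubset_iff_of_subset ?_ |>.2 ⟨r', ?_, ?_⟩)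
  · intro x hx
    rw [Finset.mem_filter] at hx ⊢
    exact ⟨hx.1, hx.2.trans N h⟩
  · exact Finset.mem_filter.2 ⟨hr', h⟩
  · exact fun hx => N.not_precedes_self u r' (Finset.mem_filter.1 hx).2

theorem slot_lt_of_precedes {u r r' : V} (hr' : r' ∈ S) (h : N.Precedes u r' r) :
    N.slot S r' u < N.slot S r u := by
  have h1 := N.sourceRank_lt hr' h
  unfold slot
  unfold Precedes at h
  omega

/-- Slots strictly increase along a total order. This keeps each node to one distance per round and,
in the reversed schedule, to one report per round. -/
theorem slot_injOn {u r r' : V} (hr : r ∈ S) (hr' : r' ∈ S) (h : N.slot S r u = N.slot S r' u) :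
    r = r' := by
  by_contra hne
  rcases N.precedes_or_precedes u hne with h1 | h1
  · exact (N.slot_lt_of_precedes hr h1).ne h
  · exact (N.slot_lt_of_precedes hr' h1).ne' h

theorem slot_lt {r : V} (hr : r ∈ S) (u : V) : N.slot S r u < N.diam + S.card := by
  have h1 := N.dist_le_diam r u
  have h2 : N.sourceRank S r u < S.card :=
    Finset.card_lt_card ((Finset.filter_ssubset).2 ⟨r, hr, N.not_precedes_self u r⟩)
  unfold slot
  omega

theorem dist_le_slot (r u : V) : N.dist r u ≤ N.slot S r u := Nat.le_add_right _ _

/-- For a source `x` preceding `r` at `v`, the triangle inequality bounds its distance from `u` by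
`d(x,v) + w(u,v)`, while `d(r,u)` equals `d(r,v) + w(u,v)`. So `x` still precedes `r` at `u`, and
the rank does not drop on the way from `v` to `u`. -/
theorem slot_add_weight_le {r u v : V} (hv : v ∈ N.parentCandidates r u) :
    N.slot S r v + N.weight s(u, v) ≤ N.slot S r u := by
  rw [mem_parentCandidates] at hv
  have h : N.sourceRank S r v ≤ N.sourceRank S r u := by
    refine Finset.card_le_card fun x hx => ?_
    rw [Finset.mem_filter] at hx ⊢
    refine ⟨hx.1, ?_⟩
    have h1 := hx.2
    have h2 := N.dist_le_add_weight x hv.1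
    unfold Precedes at h1 ⊢
    omega
  unfold slot
  omega

end Setup

/-! ### Announcement of distances -/

section Tokens

variable {V : Type} [Fintype V] {N : Network V} {S : Finset V}

/-- In round `t`, exactly the right distances are announced. -/
def TokensCorrect (N : Network V) (S : Finset V) (t : ℕ) : Prop :=
  ∀ u q, (N.state S t u).token = some q ↔
    ∃ r ∈ S, q = (N.dist r u, N.ident r) ∧ N.slot S r u = t

theorem mem_offers {t : ℕ} (h : ∀ s < t, N.TokensCorrect S s) {u : V} {j : ℕ} {p : ℕ × ℕ} :
    p ∈ (N.state S t u).offers j ↔ (u ∈ S ∧ j = N.ident u ∧ p = (0, 0)) ∨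
      ∃ v, N.graph.Adj u v ∧ ∃ r ∈ S, j = N.ident r ∧ N.slot S r v + N.latency s(u, v) ≤ t ∧
        p = (N.dist r v + N.weight s(u, v), N.ident v) := by
  unfold NodeState.offers
  rw [Set.mem_ofPred_eq, state_input]
  refine or_congr Iff.rfl ?_
  obtain ⟨x, y⟩ := p
  constructor
  · rintro ⟨w, d, m, hl, hm, htok, hx⟩
    obtain ⟨v, hadj, hy, hw⟩ := (N.mem_links S).1 hl
    dsimp only at hy hx hm
    rw [← hy, N.mem_inbox_ident S hadj] at hm
    obtain ⟨s, hs, rfl⟩ := hm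
    have hpos := N.latency_pos_of_adj hadj
    obtain ⟨r, hr, hq, hslot⟩ := (h s (by omega) v _).1 htok
    obtain ⟨hd, hj⟩ := Prod.mk.inj hq
    exact ⟨v, hadj, r, hr, hj, by omega, by rw [hx, hd, hw, hy]⟩
  · rintro ⟨v, hadj, r, hr, hj, hs, hp⟩
    obtain ⟨hx, hy⟩ := Prod.mk.inj hp
    have hpos := N.latency_pos_of_adj hadj
    refine ⟨_, N.dist r v, (N.state S (N.slot S r v) v).packet (N.ident u),
      (N.mem_links S).2 ⟨v, hadj, hy.symm, rfl⟩, ?_, ?_, hx⟩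
    · dsimp only
      rw [hy, N.mem_inbox_ident S hadj]
      exact ⟨_, hs, rfl⟩
    · exact (h _ (by omega) v _).2 ⟨r, hr, by rw [hj], rfl⟩

/-- The routes known to `u` at time `t` are correct if they are due, and never too short. -/
structure RoutesCorrect (N : Network V) (S : Finset V) (t : ℕ) (u : V) : Prop where
  route_eq : ∀ r ∈ S, N.slot S r u ≤ t →
    (N.state S t u).route (N.ident r) = some (N.dist r u, N.parentIdent r u)
  of_route : ∀ j p, (N.state S t u).route j = some p →
    ∃ r ∈ S, j = N.ident r ∧ N.dist r u ≤ p.1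

/-- By the slot inequality the announcement of the true parent has arrived by the slot of `u`. All
offers come from correct announcements, hence none is too short, and ties are broken by identifier
just as in `parentOf`. -/
theorem routesCorrect_of_tokensCorrect (hlat : N.LatencyLeWeight)
    {t : ℕ} (h : ∀ s < t, N.TokensCorrect S s) (u : V) : N.RoutesCorrect S t u where
  route_eq r hr hslot := by
    by_cases hu : u = r
    · subst hu
      refine lexMin_eq_some ((mem_offers h).2 (Or.inl ⟨hr, rfl, ?_⟩)) fun q _ => ?_
      · simp [dist_self, parentIdent]
      · simp only [dist_self, parentIdent, if_pos]
        omega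
    · have hadj := N.adj_parentOf hu
      have h1 := N.slot_add_weight_le (S := S) (N.parentOf_spec hu).1
      have h2 := hlat hadj
      refine lexMin_eq_some ((mem_offers h).2 (Or.inr ⟨N.parentOf r u, hadj, r, hr, rfl,
        by omega, ?_⟩)) fun q hq => ?_
      · rw [N.dist_parentOf hu, parentIdent, if_neg hu]
      · rcases (mem_offers h).1 hq with ⟨-, hj, -⟩ | ⟨v, hadj', r', -, hj, -, rfl⟩
        · exact absurd (N.ident_injective hj).symm hu
        · obtain rfl := N.ident_injective hj
          have h3 := N.dist_le_add_weight r hadj'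
          rcases h3.lt_or_eq with h4 | h4
          · exact Or.inl h4
          · refine Or.inr ⟨h4, ?_⟩
            simp only [parentIdent, if_neg hu]
            exact (N.parentOf_spec hu).2 v (N.mem_parentCandidates.2 ⟨hadj', h4.symm⟩)
  of_route j p hp := by
    rcases (mem_offers h).1 (lexMin_mem hp) with ⟨hu, hj, rfl⟩ | ⟨v, hadj, r, hr, hj, -, rfl⟩
    · exact ⟨u, hu, hj, by rw [dist_self]⟩
    · exact ⟨r, hr, hj, N.dist_le_add_weight r hadj⟩

namespace RoutesCorrect

variable {t : ℕ} {u : V}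

theorem finite_routes (h : N.RoutesCorrect S t u) :
    {i | ∃ p, (N.state S t u).route i = some p}.Finite := by
  refine (S.image N.ident).finite_toSet.subset ?_
  rintro i ⟨p, hp⟩
  obtain ⟨r, hr, rfl, -⟩ := h.of_route i p hp
  exact Finset.mem_coe.2 (Finset.mem_image_of_mem _ hr)

theorem rank_eq (h : N.RoutesCorrect S t u) {r : V} (hslot : N.slot S r u ≤ t) :
    (N.state S t u).rank (N.dist r u) (N.ident r) = N.sourceRank S r u := by
  unfold NodeState.rank sourceRank
  rw [← Finset.card_image_of_injective _ N.ident_injective, ← Set.ncard_coe_finset]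
  congr 1
  ext i
  simp only [Set.mem_ofPred_eq, Finset.coe_image, Set.mem_image, Finset.mem_coe, Finset.mem_filter]
  constructor
  · rintro ⟨p, hp, hlt⟩
    obtain ⟨r', hr', rfl, hle⟩ := h.of_route i p hp
    refine ⟨r', ⟨hr', ?_⟩, rfl⟩
    unfold Precedes
    omega
  · rintro ⟨r', ⟨hr', hlt⟩, rfl⟩
    have h1 := N.slot_lt_of_precedes hr' hlt
    exact ⟨_, h.route_eq r' hr' (by omega), hlt⟩

/-- A provisional estimate may have both a wrong distance and a wrong rank, yet it never looks due.
Among the sources with slots after `t` let `r₀` be the earliest. Its predecessors are all known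
exactly and count towards the provisional rank of `r`; the provisional distance is at least that of
`r₀`. So the provisional slot is at least that of `r₀`. -/
theorem lt_add_rank (h : N.RoutesCorrect S t u) {r : V} (hr : r ∈ S) (hslot : t < N.slot S r u)
    {p : ℕ × ℕ} (hp : (N.state S t u).route (N.ident r) = some p) :
    t < p.1 + (N.state S t u).rank p.1 (N.ident r) := by
  obtain ⟨r₀, hr₀, hmin⟩ := Finset.exists_min_image (S.filter fun x => t < N.slot S x u)
    (fun x => N.slot S x u) ⟨r, Finset.mem_filter.2 ⟨hr, hslot⟩⟩
  rw [Finset.mem_filter] at hr₀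
  have hpre : r₀ = r ∨ N.Precedes u r₀ r := by
    by_contra hcon
    rw [not_or] at hcon
    rcases N.precedes_or_precedes u hcon.1 with h1 | h1
    · exact hcon.2 h1
    · have h2 := N.slot_lt_of_precedes hr h1
      have h3 := hmin r (Finset.mem_filter.2 ⟨hr, hslot⟩)
      omega
  obtain ⟨r', hr', hrr', hle⟩ := h.of_route _ p hp
  obtain rfl := N.ident_injective hrr'
  have h1 : N.sourceRank S r₀ u ≤ (N.state S t u).rank p.1 (N.ident r) := by
    unfold NodeState.rank sourceRank
    rw [← Finset.card_image_of_injective _ N.ident_injective, ← Set.ncard_coe_finset]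
    refine Set.ncard_le_ncard ?_ (h.finite_routes.subset fun i ⟨q, hq, _⟩ => ⟨q, hq⟩)
    intro i hi
    simp only [Finset.coe_image, Set.mem_image, Finset.mem_coe, Finset.mem_filter] at hi
    obtain ⟨x, ⟨hx, hlt⟩, rfl⟩ := hi
    have h2 : N.slot S x u ≤ t := by
      by_contra hcon
      have h3 := hmin x (Finset.mem_filter.2 ⟨hx, by omega⟩)
      have h4 := N.slot_lt_of_precedes hx hlt
      omega
    refine ⟨_, h.route_eq x hx h2, ?_⟩
    have h5 : N.Precedes u x r := by
      rcases hpre with rfl | h6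
      · exact hlt
      · exact hlt.trans N h6
    unfold Precedes at h5
    dsimp only
    omega
  have h2 : N.dist r₀ u ≤ N.dist r u := by
    rcases hpre with rfl | h6
    · exact le_rfl
    · unfold Precedes at h6
      omega
  have h3 := hr₀.2
  unfold slot at h3
  omega

theorem tokens (h : N.RoutesCorrect S t u) (q : ℕ × ℕ) : (N.state S t u).token = some q ↔
    ∃ r ∈ S, q = (N.dist r u, N.ident r) ∧ N.slot S r u = t := by
  have key : ∀ q : ℕ × ℕ, (∃ p, (N.state S t u).route q.2 = some (q.1, p) ∧
      q.1 + (N.state S t u).rank q.1 q.2 = t) →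
      ∃ r ∈ S, q = (N.dist r u, N.ident r) ∧ N.slot S r u = t := by
    rintro ⟨d, j⟩ ⟨p, hp, hsum⟩
    obtain ⟨r, hr, hj, -⟩ := h.of_route _ _ hp
    dsimp only at hj hp hsum
    subst hj
    by_cases hslot : N.slot S r u ≤ t
    · rw [h.route_eq r hr hslot] at hp
      cases hp
      rw [h.rank_eq hslot] at hsum
      exact ⟨r, hr, rfl, hsum⟩
    · have := h.lt_add_rank hr (by omega) hp
      dsimp only at this
      omega
  unfold NodeState.token
  rw [state_time]
  constructor
  · exact fun hq => key q (lexMin_mem hq)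
  · rintro ⟨r, hr, rfl, hslot⟩
    refine lexMin_eq_some ⟨_, h.route_eq r hr hslot.le, ?_⟩ fun q hq => ?_
    · rw [h.rank_eq hslot.le]
      exact hslot
    · obtain ⟨r', hr', rfl, hslot'⟩ := key q hq
      obtain rfl := N.slot_injOn hr hr' (hslot.trans hslot'.symm)
      exact Or.inr ⟨rfl, le_rfl⟩

end RoutesCorrect

theorem tokensCorrect (hlat : N.LatencyLeWeight) (t : ℕ) :
    N.TokensCorrect S t := by
  induction t using Nat.strong_induction_on with
  | _ t ih => exact fun u q => (routesCorrect_of_tokensCorrect hlat ih u).tokens q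

theorem routesCorrect (hlat : N.LatencyLeWeight) (t : ℕ) (u : V) :
    N.RoutesCorrect S t u :=
  routesCorrect_of_tokensCorrect hlat (fun s _ => tokensCorrect hlat s) u

/-- The local test is sound because, by `lt_add_rank`, a source whose slot is still to come has a
provisional slot after `t` as well. -/
theorem complete_iff (hlat : N.LatencyLeWeight) {t : ℕ} {u : V} :
    (N.state S t u).complete ↔ ∀ r ∈ S, N.slot S r u ≤ t := by
  have h := routesCorrect (S := S) hlat t u
  have hsub : (N.state S t u).sources ⊆ (S.image N.ident : Finset ℕ) := by
    rintro i ⟨p, hp⟩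
    obtain ⟨r, hr, rfl, -⟩ := h.of_route i p hp
    exact Finset.mem_coe.2 (Finset.mem_image_of_mem _ hr)
  have hcard : ((S.image N.ident : Finset ℕ) : Set ℕ).ncard = S.card := by
    rw [Set.ncard_coe_finset, Finset.card_image_of_injective _ N.ident_injective]
  unfold NodeState.complete
  rw [state_input, state_time]
  constructor
  · rintro ⟨hn, hslots⟩ r hr
    have heq := Set.eq_of_subset_of_ncard_le hsub (by rw [hcard]; exact hn.ge)
      (Finset.finite_toSet _)
    obtain ⟨⟨d, p⟩, hp⟩ : N.ident r ∈ (N.state S t u).sources := by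
      rw [heq]
      exact Finset.mem_coe.2 (Finset.mem_image_of_mem _ hr)
    by_contra hcon
    exact (h.lt_add_rank hr (by omega) hp).not_ge (hslots _ _ _ hp)
  · intro hall
    refine ⟨?_, fun j d p hp => ?_⟩
    · change _ = S.card
      rw [← hcard]
      congr 1
      refine hsub.antisymm fun i hi => ?_
      obtain ⟨r, hr, rfl⟩ := Finset.mem_image.1 (Finset.mem_coe.1 hi)
      exact ⟨_, h.route_eq r hr (hall r hr)⟩
    · obtain ⟨r, hr, rfl, -⟩ := h.of_route _ _ hp
      have h1 := h.route_eq r hr (hall r hr)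
      rw [hp] at h1
      cases h1
      rw [h.rank_eq (hall r hr)]
      exact hall r hr

end Tokens

/-! ### Counting complete nodes -/

section Counting

variable {V : Type} [Fintype V] {N : Network V} {S : Finset V}

theorem sum_neighbors_ite_children (N : Network V) (r u : V) (f : V → ℕ) :
    ∑ v ∈ Finset.univ.filter (N.graph.Adj u),
      (if v ∈ childrenOf r (N.parentOf r) u then f v else 0) =
        ∑ c ∈ childrenOf r (N.parentOf r) u, f c := by
  rw [← Finset.sum_filter, Finset.filter_filter]
  refine Finset.sum_congr ?_ fun _ _ => rfl
  ext v
  simp only [Finset.mem_filter, Finset.mem_univ, true_and, and_iff_right_iff_imp]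
  intro hv
  have h := mem_childrenOf.1 hv
  rw [← h.2]
  exact (N.adj_parentOf h.1).symm

/-- All distances from `y` to the sources are final at time `t`. -/
def Done (N : Network V) (S : Finset V) (t : ℕ) (y : V) : Prop := ∀ r ∈ S, N.slot S r y ≤ t

theorem Done.mono {s t : ℕ} {y : V} (h : N.Done S s y) (hst : s ≤ t) : N.Done S t y :=
  fun r hr => (h r hr).trans hst

/-- `r₀` is the source with the smallest identifier. -/
structure IsLeader (N : Network V) (S : Finset V) (r₀ : V) : Prop where
  mem : r₀ ∈ S
  le : ∀ r ∈ S, N.ident r₀ ≤ N.ident r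

theorem parent_eq_some_iff (hlat : N.LatencyLeWeight) {t : ℕ} {r u v : V} (hr : r ∈ S)
    (hslot : N.slot S r u ≤ t) :
    (N.state S t u).parent (N.ident r) = some (N.ident v) ↔ u ≠ r ∧ N.parentOf r u = v := by
  unfold NodeState.parent
  rw [(routesCorrect hlat t u).route_eq r hr hslot, ← parentIdent_eq_ident]
  have := N.ident_pos v
  rw [Option.bind_some]
  split_ifs with h
  · simp only [false_iff]
    dsimp only at h
    omega
  · simp

theorem leader_eq (hlat : N.LatencyLeWeight) {r₀ : V} (h₀ : N.IsLeader S r₀) {t : ℕ} {u : V}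
    (hdone : N.Done S t u) : (N.state S t u).leader = N.ident r₀ := by
  have hR := routesCorrect (S := S) hlat t u
  have hmem : N.ident r₀ ∈ (N.state S t u).sources :=
    ⟨_, hR.route_eq r₀ h₀.mem (hdone r₀ h₀.mem)⟩
  refine le_antisymm (Nat.sInf_le hmem) ?_
  obtain ⟨p, hp⟩ := Nat.sInf_mem ⟨_, hmem⟩
  obtain ⟨r, hr, hj, -⟩ := hR.of_route _ p hp
  exact (h₀.le r hr).trans hj.ge

theorem packet_count_eq (hlat : N.LatencyLeWeight) {r₀ : V} (h₀ : N.IsLeader S r₀) (t : ℕ)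
    (u v : V) : ((N.state S t v).packet (N.ident u)).count =
      if N.Done S t v ∧ v ∈ childrenOf r₀ (N.parentOf r₀) u then (N.state S t v).counted else 0 := by
  unfold NodeState.packet
  dsimp only
  have hiff : (N.state S t v).complete ↔ N.Done S t v := complete_iff hlat
  rw [hiff]
  by_cases hd : N.Done S t v
  · simp only [leader_eq hlat h₀ hd, parent_eq_some_iff hlat h₀.mem (hd r₀ h₀.mem), mem_childrenOf]
  · rw [if_neg fun h => hd h.1, if_neg fun h => hd h.1]

/-- Received counts may be outdated, but finished nodes stay finished, so they never overestimate.
-/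
theorem counted_le (hlat : N.LatencyLeWeight) {r₀ : V} (h₀ : N.IsLeader S r₀) (t : ℕ) (u : V) :
    (N.state S t u).counted ≤
      ∑ y ∈ descendants (N.parentOf r₀) u, if N.Done S t y then 1 else 0 := by
  induction t using Nat.strong_induction_on generalizing u with
  | _ t ih =>
    unfold NodeState.counted
    split_ifs with hc
    · rw [complete_iff hlat] at hc
      rw [state_input, sum_links, (N.isParentMap r₀).sum_descendants N.weight_pos,
        if_pos (show N.Done S t u from hc), ← N.sum_neighbors_ite_children r₀ u]
      refine Nat.add_le_add_left (Finset.sum_le_sum fun v hv => ?_) 1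
      have hadj : N.graph.Adj u v := by simpa using hv
      refine csSup_le' ?_
      rintro c ⟨m, hm, rfl⟩
      obtain ⟨s, hs, rfl⟩ := (N.mem_inbox_ident S hadj).1 hm
      have hpos := N.latency_pos_of_adj hadj
      rw [packet_count_eq hlat h₀]
      split_ifs with h1 h2 h2
      · refine (ih s (by omega) v).trans (Finset.sum_le_sum fun _ _ => ?_)
        split_ifs with h3 h4
        · exact le_rfl
        · exact absurd (h3.mono (by omega)) h4
        · exact Nat.zero_le _
        · exact le_rfl
      · exact absurd h1.2 h2
      · exact Nat.zero_le _
      · exact le_rfl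
    · exact Nat.zero_le _

theorem counted_le_card (hlat : N.LatencyLeWeight) {r₀ : V} (h₀ : N.IsLeader S r₀) (t : ℕ)
    (u : V) : (N.state S t u).counted ≤ Fintype.card V := by
  refine (counted_le hlat h₀ t u).trans ?_
  rw [← Finset.sum_filter, ← Finset.card_eq_sum_ones]
  exact Finset.card_le_univ _

/-- Once all nodes are finished at time `T`, full counts climb the leader's tree: a node at distance
`d` from the leader has its count by time `T + E - d`, since latencies do not exceed the differences
of depth. -/
theorem card_descendants_le_counted (hlat : N.LatencyLeWeight) {r₀ : V} (h₀ : N.IsLeader S r₀)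
    {T E : ℕ} (hT : ∀ y, N.Done S T y) (hE : ∀ y, N.dist r₀ y ≤ E) {t : ℕ} {u : V}
    (ht : T + E ≤ t + N.dist r₀ u) :
    ∑ _ ∈ descendants (N.parentOf r₀) u, 1 ≤ (N.state S t u).counted := by
  induction t using Nat.strong_induction_on generalizing u with
  | _ t ih =>
    have hdone : N.Done S t u := (hT u).mono (by have := hE u; omega)
    unfold NodeState.counted
    rw [if_pos ((complete_iff hlat).2 hdone), state_input, sum_links,
      (N.isParentMap r₀).sum_descendants N.weight_pos, ← N.sum_neighbors_ite_children r₀ u]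
    refine Nat.add_le_add_left (Finset.sum_le_sum fun v hv => ?_) 1
    have hadj : N.graph.Adj u v := by simpa using hv
    split_ifs with hchild
    · have hv0 := mem_childrenOf.1 hchild
      have hd := N.dist_parentOf hv0.1
      rw [hv0.2, Sym2.eq_swap] at hd
      have hl := hlat hadj
      have hpos := N.latency_pos_of_adj hadj
      have hEv := hE v
      have hs : T + E ≤ t - N.latency s(u, v) + N.dist r₀ v := by omega
      refine (ih (t - N.latency s(u, v)) (by omega) hs).trans ?_
      -- `sSup` of an unbounded set of naturals would be `0`, so a bound on the received counts is
      -- needed.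
      refine le_csSup ⟨Fintype.card V, ?_⟩ ⟨_, (N.mem_inbox_ident S hadj).2
        ⟨t - N.latency s(u, v), by omega, rfl⟩, ?_⟩
      · rintro c ⟨m, hm, rfl⟩
        obtain ⟨s, -, rfl⟩ := (N.mem_inbox_ident S hadj).1 hm
        rw [packet_count_eq hlat h₀]
        split_ifs
        · exact counted_le_card hlat h₀ s v
        · exact Nat.zero_le _
      · rw [packet_count_eq hlat h₀, if_pos ⟨(hT v).mono (by omega), hchild⟩]
    · exact Nat.zero_le _

/-- The leader's count is at most the number of finished nodes; if it equals `n`, no node is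
missing. -/
theorem done_of_ready (hlat : N.LatencyLeWeight) {r₀ : V} (h₀ : N.IsLeader S r₀) {t : ℕ} {u : V}
    (h : (N.state S t u).ready) : u = r₀ ∧ ∀ y, N.Done S t y := by
  obtain ⟨hc, hl, hn⟩ := h
  rw [leader_eq hlat h₀ ((complete_iff hlat).1 hc), state_input] at hl
  obtain rfl : r₀ = u := N.ident_injective hl
  refine ⟨rfl, ?_⟩
  have h1 := counted_le hlat h₀ t r₀
  rw [hn, state_input, (N.isParentMap r₀).descendants_root N.weight_pos, ← Finset.sum_filter,
    ← Finset.card_eq_sum_ones] at h1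
  have h2 := Finset.eq_univ_of_card _ (le_antisymm (Finset.card_le_univ _) h1)
  intro y
  have h3 := h2 ▸ Finset.mem_univ y
  exact (Finset.mem_filter.1 h3).2

theorem ready_of_le (hlat : N.LatencyLeWeight) {r₀ : V} (h₀ : N.IsLeader S r₀) {T E t : ℕ}
    (hT : ∀ y, N.Done S T y) (hE : ∀ y, N.dist r₀ y ≤ E) (ht : T + E ≤ t) :
    (N.state S t r₀).ready := by
  have hdone : N.Done S t r₀ := (hT r₀).mono (by omega)
  refine ⟨(complete_iff hlat).2 hdone, ?_, le_antisymm ?_ ?_⟩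
  · rw [leader_eq hlat h₀ hdone, state_input]
    rfl
  · rw [state_input]
    exact counted_le_card hlat h₀ t r₀
  · have h1 := card_descendants_le_counted hlat h₀ hT hE (t := t) (u := r₀) (by omega)
    rw [(N.isParentMap r₀).descendants_root N.weight_pos, ← Finset.card_eq_sum_ones] at h1
    rw [state_input]
    exact h1

end Counting

/-! ### Agreement on the starting time of the second stage -/

section Start

variable {V : Type} [Fintype V] {N : Network V} {S : Finset V} {r₀ : V} {B : ℕ}

/-- `B` is the first round in which the leader `r₀` knows that all nodes are complete. -/
structure IsStart (N : Network V) (S : Finset V) (r₀ : V) (B : ℕ) : Prop extends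
    N.IsLeader S r₀ where
  ready : (N.state S B r₀).ready
  not_ready : ∀ t < B, ¬ (N.state S t r₀).ready

theorem exists_isStart (hlat : N.LatencyLeWeight) (hS : S.Nonempty) :
    ∃ r₀ B, N.IsStart S r₀ B ∧ B ≤ 2 * (N.diam + S.card) := by
  obtain ⟨r₀, hr₀, hmin⟩ := Finset.exists_min_image S N.ident hS
  have h₀ : N.IsLeader S r₀ := ⟨hr₀, hmin⟩
  -- All slots are below `D + |S|`, and the counts need at most `D` further rounds.
  have hready := ready_of_le hlat h₀ (T := N.diam + S.card) (E := N.diam)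
    (t := 2 * (N.diam + S.card)) (fun y r hr => (N.slot_lt hr y).le)
    (fun y => N.dist_le_diam r₀ y) (by omega)
  have hex : ∃ t, (N.state S t r₀).ready := ⟨_, hready⟩
  exact ⟨r₀, Nat.find hex, ⟨h₀, Nat.find_spec hex, fun t ht => Nat.find_min hex ht⟩,
    Nat.find_min' hex hready⟩

theorem _root_.MRCT.NodeState.startTime_mem {s : NodeState} {b : ℕ} (h : s.startTime = some b) :
    b ∈ s.startTimes := by
  unfold NodeState.startTime at h
  split_ifs at h with hne
  cases h
  exact Nat.sInf_mem hne

theorem _root_.MRCT.NodeState.startTime_le {s : NodeState} {b c : ℕ} (h : s.startTime = some b)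
    (hc : c ∈ s.startTimes) : b ≤ c := by
  unfold NodeState.startTime at h
  split_ifs at h with hne
  cases h
  exact Nat.sInf_le hc

theorem _root_.MRCT.NodeState.exists_startTime {s : NodeState} {b : ℕ} (h : b ∈ s.startTimes) :
    ∃ c, s.startTime = some c := by
  unfold NodeState.startTime
  rw [if_pos ⟨b, h⟩]
  exact ⟨_, rfl⟩

namespace IsStart

theorem slot_le (hB : N.IsStart S r₀ B) (hlat : N.LatencyLeWeight) {r : V} (hr : r ∈ S) (u : V) :
    N.slot S r u ≤ B :=
  (done_of_ready hlat hB.toIsLeader hB.ready).2 u r hr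

theorem dist_le (hB : N.IsStart S r₀ B) (hlat : N.LatencyLeWeight) {r : V} (hr : r ∈ S) (u : V) :
    N.dist r u ≤ B :=
  (N.dist_le_slot r u).trans (hB.slot_le hlat hr u)

theorem exists_startTime_leader (hB : N.IsStart S r₀ B) {t : ℕ} (ht : B ≤ t) :
    ∃ b, (N.state S t r₀).startTime = some b := by
  induction t, ht using Nat.le_induction with
  | base => exact NodeState.exists_startTime (Or.inr (Or.inr ⟨hB.ready, rfl⟩))
  | succ t _ ih =>
    obtain ⟨b, hb⟩ := ih
    exact NodeState.exists_startTime (Or.inl ((N.state_started_succ S t r₀).trans hb))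

/-- Only the leader creates a starting time. It remains ready after round `B`, but then already
stores `B`, and taking the minimum discards the later times. -/
theorem of_startTime (hB : N.IsStart S r₀ B) (hlat : N.LatencyLeWeight) {t : ℕ} {u : V} {b : ℕ}
    (h : (N.state S t u).startTime = some b) : b = B ∧ B ≤ t := by
  induction t using Nat.strong_induction_on generalizing u b with
  | _ t ih =>
    rcases NodeState.startTime_mem h with h1 | ⟨i, m, hm, h1⟩ | ⟨h1, h2⟩
    · cases t with
      | zero =>
        rw [state_started_zero] at h1
        cases h1
      | succ t =>
        rw [state_started_succ] at h1
        have := ih t (by omega) h1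
        omega
    · obtain ⟨v, s, hadj, -, hs, rfl⟩ := (N.mem_inbox S).1 hm
      have hpos := N.latency_pos_of_adj hadj
      have := ih s (by omega) (u := v) h1
      omega
    · obtain ⟨rfl, -⟩ := done_of_ready hlat hB.toIsLeader h1
      rw [state_time] at h2
      have h3 : B ≤ t := by
        by_contra hcon
        exact hB.not_ready t (by omega) h1
      rcases h3.eq_or_lt with h4 | h4
      · omega
      · obtain ⟨s, rfl⟩ := Nat.exists_eq_add_one_of_ne_zero (by omega : t ≠ 0)
        obtain ⟨c, hc⟩ := hB.exists_startTime_leader (t := s) (by omega)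
        have h5 := ih s (by omega) hc
        have h6 := NodeState.startTime_le h (c := c)
          (Or.inl ((N.state_started_succ S s u).trans hc))
        omega

/-- The starting time travels down the leader's tree, each edge costing at most its weight. -/
theorem startTime_eq (hB : N.IsStart S r₀ B) (hlat : N.LatencyLeWeight) {t : ℕ} {u : V}
    (ht : B + N.dist r₀ u ≤ t) : (N.state S t u).startTime = some B := by
  induction t using Nat.strong_induction_on generalizing u with
  | _ t ih =>
    have hex : ∃ b, (N.state S t u).startTime = some b := by
      by_cases hu : u = r₀
      · subst hu
        exact hB.exists_startTime_leader (by omega)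
      · have hadj := N.adj_parentOf hu
        have hd := N.dist_parentOf hu
        have hl := hlat hadj
        have hpos := N.latency_pos_of_adj hadj
        have h1 := ih (t - N.latency s(u, N.parentOf r₀ u)) (by omega) (u := N.parentOf r₀ u)
          (by omega)
        exact NodeState.exists_startTime (Or.inr (Or.inl ⟨_, _, (N.mem_inbox_ident S hadj).2
          ⟨t - N.latency s(u, N.parentOf r₀ u), by omega, rfl⟩, h1⟩))
    obtain ⟨b, hb⟩ := hex
    rw [hb, (hB.of_startTime hlat hb).1]

theorem startTime_eq_of_two_mul_le (hB : N.IsStart S r₀ B) (hlat : N.LatencyLeWeight) {t : ℕ}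
    (u : V) (ht : 2 * B ≤ t) : (N.state S t u).startTime = some B :=
  hB.startTime_eq hlat (by have := hB.dist_le hlat hB.mem u; omega)

/-! ### Reports -/

theorem mem_due (hB : N.IsStart S r₀ B) (hlat : N.LatencyLeWeight) {t : ℕ} {u v : V} {j : ℕ} :
    j ∈ (N.state S t u).due (N.ident v) ↔
      ∃ r ∈ S, j = N.ident r ∧ u ≠ r ∧ N.parentOf r u = v ∧ t + N.slot S r u = 3 * B := by
  have hR := routesCorrect (S := S) hlat t u
  unfold NodeState.due
  rw [Set.mem_ofPred_eq, state_time]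
  constructor
  · rintro ⟨b, d, hb, hroute, hsum⟩
    obtain ⟨rfl, hle⟩ := hB.of_startTime hlat hb
    obtain ⟨r, hr, rfl, -⟩ := hR.of_route _ _ hroute
    have hslot := (hB.slot_le hlat hr u).trans hle
    rw [hR.route_eq r hr hslot] at hroute
    obtain ⟨rfl, hp⟩ := Prod.mk.inj (Option.some.inj hroute)
    rw [hR.rank_eq hslot] at hsum
    obtain ⟨hne, hpar⟩ := N.parentIdent_eq_ident.1 hp
    exact ⟨r, hr, rfl, hne, hpar, hsum⟩
  · rintro ⟨r, hr, rfl, hne, hpar, hsum⟩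
    have h1 := hB.slot_le hlat hr u
    -- As slots are at most `B`, a report is due no earlier than round `2 * B`, when routes are
    -- final and `B` is known everywhere.
    have hslot : N.slot S r u ≤ t := by omega
    refine ⟨B, N.dist r u, hB.startTime_eq_of_two_mul_le hlat u (by omega), ?_, ?_⟩
    · rw [hR.route_eq r hr hslot, N.parentIdent_eq_ident.2 ⟨hne, hpar⟩]
    · rw [hR.rank_eq hslot]
      exact hsum

theorem due_eq (hB : N.IsStart S r₀ B) (hlat : N.LatencyLeWeight) {t : ℕ} {r u v : V}
    (hr : r ∈ S) (hne : u ≠ r) (hpar : N.parentOf r u = v) (hsum : t + N.slot S r u = 3 * B) :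
    (N.state S t u).due (N.ident v) = {N.ident r} := by
  ext j
  rw [hB.mem_due hlat, Set.mem_singleton_iff]
  constructor
  · rintro ⟨r', hr', rfl, -, -, hsum'⟩
    rw [N.slot_injOn (u := u) hr hr' (by omega)]
  · rintro rfl
    exact ⟨r, hr, rfl, hne, hpar, hsum⟩

theorem report_eq_some_iff (hB : N.IsStart S r₀ B) (hlat : N.LatencyLeWeight) {t : ℕ} {u v : V}
    {j z c : ℕ} : (N.state S t u).report (N.ident v) = some (j, z, c) ↔
      ∃ r ∈ S, j = N.ident r ∧ u ≠ r ∧ N.parentOf r u = v ∧ t + N.slot S r u = 3 * B ∧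
        z = (N.state S t u).size (N.ident r) ∧ c = (N.state S t u).cost (N.ident r) := by
  unfold NodeState.report
  constructor
  · intro h
    split_ifs at h with hne
    obtain ⟨i, hi⟩ := hne
    obtain ⟨r, hr, rfl, hur, hpar, hsum⟩ := (hB.mem_due hlat).1 hi
    rw [hB.due_eq hlat hr hur hpar hsum, csInf_singleton] at h
    cases h
    exact ⟨r, hr, rfl, hur, hpar, hsum, rfl, rfl⟩
  · rintro ⟨r, hr, rfl, hur, hpar, hsum, rfl, rfl⟩
    rw [hB.due_eq hlat hr hur hpar hsum, csInf_singleton, if_pos (Set.singleton_nonempty _)]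

/-- A child `v` of `u` reports in round `3 * B - slot r v`. By `slot_add_weight_le` this is at least
the weight of the edge before `3 * B - slot r u`, so all children have been heard by then. The bound
on `t` is one-sided, as the values must also persist. -/
theorem size_eq_and_cost_eq (hB : N.IsStart S r₀ B) (hlat : N.LatencyLeWeight) {t : ℕ} {r u : V}
    (hr : r ∈ S) (ht : 3 * B ≤ t + N.slot S r u) :
    (N.state S t u).size (N.ident r) = subtreeCount S (N.parentOf r) u ∧
    (N.state S t u).cost (N.ident r) = subtreeRoutingCost N.weight S r (N.parentOf r) u := by
  induction t using Nat.strong_induction_on generalizing u with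
  | _ t ih =>
    have hmem : ∀ v, N.graph.Adj u v → ∀ z c, (∃ m, (N.ident v, m) ∈ (N.state S t u).inbox ∧
        m.report = some (N.ident r, z, c)) ↔ v ∈ childrenOf r (N.parentOf r) u ∧
          z = subtreeCount S (N.parentOf r) v ∧
          c = subtreeRoutingCost N.weight S r (N.parentOf r) v := by
      intro v hadj z c
      have hpos := N.latency_pos_of_adj hadj
      rw [mem_childrenOf]
      constructor
      · rintro ⟨m, hm, hrep⟩
        obtain ⟨s, hs, rfl⟩ := (N.mem_inbox_ident S hadj).1 hm
        obtain ⟨r', -, hj, hne, hpar, hsum, rfl, rfl⟩ := (hB.report_eq_some_iff hlat).1 hrep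
        obtain rfl := N.ident_injective hj
        exact ⟨⟨hne, hpar⟩, ih s (by omega) (by omega)⟩
      · rintro ⟨⟨hne, hpar⟩, rfl, rfl⟩
        have h1 := N.slot_add_weight_le (S := S) (N.parentOf_spec hne).1
        rw [hpar, Sym2.eq_swap] at h1
        have h2 := hlat hadj
        have h3 := hB.slot_le hlat hr v
        have h4 := ih (3 * B - N.slot S r v) (by omega) (u := v) (by omega)
        exact ⟨_, (N.mem_inbox_ident S hadj).2 ⟨3 * B - N.slot S r v, by omega, rfl⟩,
          (hB.report_eq_some_iff hlat).2
            ⟨r, hr, rfl, hne, hpar, by omega, h4.1.symm, h4.2.symm⟩⟩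
    have hsize : ∀ v, N.graph.Adj u v → (N.state S t u).childSize (N.ident r) (N.ident v) =
        if v ∈ childrenOf r (N.parentOf r) u then subtreeCount S (N.parentOf r) v else 0 := by
      intro v hadj
      unfold NodeState.childSize
      -- A child contributes a single value; any other neighbor contributes the empty set, whose
      -- infimum is `0`.
      simp only [exists_comm (α := Packet), hmem v hadj]
      split_ifs with hv
      · simp [hv]
      · simp [hv]
    have hcost : ∀ v, N.graph.Adj u v → (N.state S t u).childCost (N.ident r) (N.ident v) =
        if v ∈ childrenOf r (N.parentOf r) u then
          subtreeRoutingCost N.weight S r (N.parentOf r) v else 0 := by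
      intro v hadj
      unfold NodeState.childCost
      simp only [exists_comm (α := Packet), hmem v hadj]
      split_ifs with hv
      · simp [hv]
      · simp [hv]
    constructor
    · unfold NodeState.size
      rw [state_input, sum_links, (N.isParentMap r).subtreeCount_rec N.weight_pos,
        ← N.sum_neighbors_ite_children r u]
      exact congrArg₂ (· + ·) (if_congr Iff.rfl rfl rfl)
        (Finset.sum_congr rfl fun v hv => hsize v (by simpa using hv))
    · unfold NodeState.cost
      rw [state_input, sum_links, (N.isParentMap r).subtreeRoutingCost_rec N.weight_pos,
        ← N.sum_neighbors_ite_children r u]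
      refine Finset.sum_congr rfl fun v hv => ?_
      have hadj : N.graph.Adj u v := by simpa using hv
      rw [hsize v hadj, hcost v hadj]
      split_ifs
      · rfl
      · simp

end IsStart

/-! ### Selection of the cheapest root -/

/-- Half the routing cost of the shortest-path tree with root `r`. -/
def rootCost (N : Network V) (S : Finset V) (r : V) : ℕ :=
  subtreeRoutingCost N.weight S r (N.parentOf r) r

/-- `r` is a cheapest root, and has the smallest identifier among the cheapest roots. -/
def IsCheapest (N : Network V) (S : Finset V) (r : V) : Prop :=
  r ∈ S ∧ ∀ x ∈ S, N.rootCost S r < N.rootCost S x ∨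
    N.rootCost S r = N.rootCost S x ∧ N.ident r ≤ N.ident x

theorem exists_isCheapest (N : Network V) (hS : S.Nonempty) : ∃ r, N.IsCheapest S r := by
  obtain ⟨r, hr⟩ := hS
  obtain ⟨p, hp⟩ := exists_lexMin
    (K := {p | ∃ r ∈ S, p = (N.rootCost S r, N.ident r)}) ⟨_, r, hr, rfl⟩
  obtain ⟨x, hx, rfl⟩ := lexMin_mem hp
  exact ⟨x, hx, fun y hy => lexMin_le hp ⟨y, hy, rfl⟩⟩

namespace IsStart

/-- Roots enter the competition only from time `3 * B` on, when their costs are exact; so nothing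
false is ever flooded. -/
theorem of_mem_candidates (hB : N.IsStart S r₀ B) (hlat : N.LatencyLeWeight) {t : ℕ} {u : V}
    {p : ℕ × ℕ} (h : p ∈ (N.state S t u).candidates) :
    ∃ r ∈ S, p = (N.rootCost S r, N.ident r) := by
  induction t using Nat.strong_induction_on generalizing u p with
  | _ t ih =>
    rcases h with ⟨i, m, hm, hbest⟩ | ⟨hu, rfl, b, hb, hle⟩
    · obtain ⟨v, s, hadj, -, hs, rfl⟩ := (N.mem_inbox S).1 hm
      have hpos := N.latency_pos_of_adj hadj
      exact ih s (by omega) (u := v) (lexMin_mem hbest)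
    · rw [state_input] at hu
      rw [state_time] at hle
      obtain ⟨rfl, -⟩ := hB.of_startTime hlat hb
      have hu' : u ∈ S := hu
      refine ⟨u, hu', ?_⟩
      rw [state_input]
      exact congrArg (·, N.ident u)
        (hB.size_eq_and_cost_eq hlat hu' (t := t) (u := u) (by omega)).2

/-- The winning pair reaches `u` along the shortest-path tree of its own root, and no other
candidate can beat it. -/
theorem best_eq (hB : N.IsStart S r₀ B) (hlat : N.LatencyLeWeight) {r : V}
    (hr : N.IsCheapest S r) {t : ℕ} {u : V} (ht : 3 * B + N.dist r u ≤ t) :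
    (N.state S t u).best = some (N.rootCost S r, N.ident r) := by
  induction t using Nat.strong_induction_on generalizing u with
  | _ t ih =>
    refine lexMin_eq_some ?_ fun q hq => ?_
    · by_cases hu : u = r
      · subst hu
        refine Or.inr ⟨?_, ?_, B, hB.startTime_eq_of_two_mul_le hlat u (by omega), ?_⟩
        · rw [state_input]
          exact hr.1
        · rw [state_input]
          exact congrArg (·, N.ident u)
            (hB.size_eq_and_cost_eq hlat hr.1 (t := t) (u := u) (by omega)).2.symm
        · rw [state_time]
          omega
      · have hadj := N.adj_parentOf hu
        have hd := N.dist_parentOf hu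
        have hl := hlat hadj
        have hpos := N.latency_pos_of_adj hadj
        have h1 := ih (t - N.latency s(u, N.parentOf r u)) (by omega) (u := N.parentOf r u)
          (by omega)
        exact Or.inl ⟨_, _, (N.mem_inbox_ident S hadj).2
          ⟨t - N.latency s(u, N.parentOf r u), by omega, rfl⟩, h1⟩
    · obtain ⟨x, hx, rfl⟩ := hB.of_mem_candidates hlat hq
      exact hr.2 x hx

end IsStart

end Start

/-! ### Timing models, message sizes and the final output -/

section Results

variable {V : Type} [Fintype V] {N : Network V} {S : Finset V} {r₀ : V} {B : ℕ}

theorem UniformWeights.latencyLeWeight (h : N.UniformWeights) : N.LatencyLeWeight :=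
  fun u v hadj => by
    rw [h.2 s(u, v) hadj]
    exact N.weight_pos_of_adj hadj

theorem TransmissionWeights.latencyLeWeight (h : N.TransmissionWeights) : N.LatencyLeWeight :=
  fun u v hadj => (h s(u, v) hadj).le

/-! ### Size of the messages -/

theorem rootCost_le (N : Network V) (S : Finset V) (r : V) :
    N.rootCost S r ≤ Fintype.card V * (Fintype.card V * N.diam) := by
  have h1 := ((N.isParentMap r).isShortestPathTree N.weight_pos).routingCost_le S
  rw [← (N.isParentMap r).two_mul_subtreeRoutingCost_root N.weight_pos S] at h1
  have h2 : ∑ u ∈ S, wdist N.graph N.weight r u ≤ S.card * N.diam :=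
    (Finset.sum_le_sum fun u _ => N.dist_le_diam r u).trans (by simp)
  have h3 : S.card ≤ Fintype.card V := Finset.card_le_univ S
  calc N.rootCost S r ≤ S.card * ∑ u ∈ S, wdist N.graph N.weight r u := by
        unfold rootCost
        rw [mul_assoc] at h1
        omega
    _ ≤ Fintype.card V * (Fintype.card V * N.diam) :=
        Nat.mul_le_mul h3 (h2.trans (Nat.mul_le_mul_right _ h3))

theorem IsStart.packet_fits (hB : N.IsStart S r₀ B) (hlat : N.LatencyLeWeight) {k : ℕ}
    (hident : ∀ v, N.ident v < 2 ^ k) (hdiam : N.diam < 2 ^ k) (hcard : Fintype.card V < 2 ^ k)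
    (hstart : B < 2 ^ k) (hcost : ∀ r, N.rootCost S r < 2 ^ k) (t : ℕ) (u v : V) :
    ((N.state S t u).packet (N.ident v)).Fits k where
  token p hp := by
    obtain ⟨r, -, rfl, -⟩ := (tokensCorrect hlat t u p).1 hp
    exact ⟨(N.dist_le_diam r u).trans_lt hdiam, hident r⟩
  count := by
    rw [packet_count_eq hlat hB.toIsLeader]
    split_ifs
    · exact (counted_le_card hlat hB.toIsLeader t u).trans_lt hcard
    · exact Nat.two_pow_pos k
  start b hb := (hB.of_startTime hlat hb).1 ▸ hstart
  report p hp := by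
    obtain ⟨j, z, c⟩ := p
    obtain ⟨r, hr, rfl, -, -, hsum, rfl, rfl⟩ := (hB.report_eq_some_iff hlat).1 hp
    obtain ⟨h1, h2⟩ := hB.size_eq_and_cost_eq hlat hr hsum.ge
    refine ⟨hident r, ?_, ?_⟩
    · dsimp only
      rw [h1]
      exact ((subtreeCount_le _ _ _).trans (Finset.card_le_univ _)).trans_lt hcard
    · dsimp only
      rw [h2]
      exact ((N.isParentMap r).subtreeRoutingCost_le_root N.weight_pos S u).trans_lt (hcost r)
  best p hp := by
    obtain ⟨r, -, rfl⟩ := hB.of_mem_candidates hlat (lexMin_mem hp)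
    exact ⟨hcost r, hident r⟩

theorem bandwidthAtMost (hlat : N.LatencyLeWeight) (hS : S.Nonempty) {a : ℕ}
    (hident : ∀ v, N.ident v ≤ Fintype.card V ^ a) :
    N.BandwidthAtMost S mrct
      ((128 * (a + 3) + 16) * Nat.log 2 (Fintype.card V + N.diam)) := by
  intro t u v hadj l hl
  obtain ⟨r₀, B, hB, hle⟩ := exists_isStart (S := S) hlat hS
  set X := Fintype.card V + N.diam with hX
  set L := Nat.log 2 X with hL
  -- A message needs an edge, hence two nodes. So the logarithm is positive and absorbs additive
  -- constants.
  have hn : 1 < Fintype.card V := Fintype.one_lt_card_iff.2 ⟨u, v, hadj.ne⟩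
  have hXtwo : 2 ≤ X := by omega
  have hLpos : 1 ≤ L := Nat.log_pos (by norm_num) hXtwo
  have hXlt : X < 2 ^ (2 * L) :=
    (Nat.lt_pow_succ_log_self (by norm_num) X).trans_le
      (Nat.pow_le_pow_right (by norm_num) (by omega))
  have hpow : ∀ {x : ℕ}, x ≤ X ^ (a + 3) → x < 2 ^ (2 * L * (a + 3)) := fun hx =>
    hx.trans_lt (by rw [pow_mul]; exact Nat.pow_lt_pow_left hXlt (by omega))
  have hmono : ∀ {i : ℕ}, i ≤ a + 3 → X ^ i ≤ X ^ (a + 3) := fun hi =>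
    Nat.pow_le_pow_right (by omega) hi
  have hone : X ≤ X ^ (a + 3) := by simpa using hmono (i := 1) (by omega)
  -- Identifiers are at most `X ^ a`, the starting time is at most `2 * X ≤ X ^ 2`, and costs are at
  -- most `X ^ 3`; the exponent `a + 3` covers all of them.
  have hfits := hB.packet_fits hlat (k := 2 * L * (a + 3))
    (fun v => hpow ((hident v).trans
      ((Nat.pow_le_pow_left (by omega) a).trans (hmono (by omega)))))
    (hpow (le_trans (by omega) hone)) (hpow (le_trans (by omega) hone))
    (hpow (le_trans ?_ (hmono (i := 2) (by omega))))
    (fun r => hpow ((N.rootCost_le S r).trans (le_trans ?_ (hmono (i := 3) (by omega))))) t u v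
  · have hlen := hfits.length_encode_le
    cases hl
    change ((N.state S t u).packet (N.ident v)).encode.length ≤ _
    refine hlen.trans ?_
    have : 16 ≤ 16 * L := by omega
    calc 64 * (2 * L * (a + 3)) + 16 ≤ 64 * (2 * L * (a + 3)) + 16 * L := by omega
      _ = (128 * (a + 3) + 16) * L := by ring
  · have hcard : S.card ≤ Fintype.card V := Finset.card_le_univ S
    have h2 : 2 * X ≤ X ^ 2 := by
      rw [pow_two]
      exact Nat.mul_le_mul_right X hXtwo
    omega
  · rw [pow_succ, pow_two, mul_assoc]
    exact Nat.mul_le_mul (by omega) (Nat.mul_le_mul (by omega) (by omega))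

/-! ### Results -/

namespace IsStart

theorem terminatesWithin (hB : N.IsStart S r₀ B) (hlat : N.LatencyLeWeight) {T : ℕ}
    (hT : 4 * B ≤ T) {out : V → Result}
    (hout : ∀ t u, 4 * B ≤ t → (N.state S t u).result = out u) :
    N.TerminatesWithin S mrct T out := by
  intro u
  refine ⟨4 * B, hT, fun s hs => ?_, fun s hs => ?_⟩
  · change (if _ then _ else _) = none
    refine if_neg ?_
    rintro ⟨b, hb, hle⟩
    change (N.state S s u).startTime = some b at hb
    change 4 * b ≤ (N.state S s u).time at hle
    rw [(hB.of_startTime hlat hb).1, state_time] at hle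
    omega
  · change (if _ then some (N.state S s u).result else none) = _
    rw [if_pos, hout s u hs]
    refine ⟨B, hB.startTime_eq_of_two_mul_le hlat u (by omega), ?_⟩
    change 4 * B ≤ (N.state S s u).time
    rw [state_time]
    exact hs

theorem route_eq_none (hlat : N.LatencyLeWeight) {j : ℕ} (hj : ¬ ∃ r ∈ S, j = N.ident r) (t : ℕ)
    (u : V) : (N.state S t u).route j = none := by
  rw [Option.eq_none_iff_forall_ne_some]
  intro p hp
  obtain ⟨r, hr, hjr, -⟩ := (routesCorrect hlat t u).of_route j p hp
  exact hj ⟨r, hr, hjr⟩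

theorem route_eq (hB : N.IsStart S r₀ B) (hlat : N.LatencyLeWeight) {t : ℕ} (ht : B ≤ t) {r : V}
    (hr : r ∈ S) (u : V) :
    (N.state S t u).route (N.ident r) = some (N.dist r u, N.parentIdent r u) :=
  (routesCorrect hlat t u).route_eq r hr ((hB.slot_le hlat hr u).trans ht)

/-- An output is a function on all of `ℕ` and must never change after termination, so its values at
numbers that identify no source matter too. -/
theorem size_eq_and_cost_eq_of_not_source (hB : N.IsStart S r₀ B) (hlat : N.LatencyLeWeight)
    {j : ℕ} (hj : ¬ ∃ r ∈ S, j = N.ident r) (t : ℕ) (u : V) :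
    (N.state S t u).size j = (if u ∈ S then 1 else 0) ∧ (N.state S t u).cost j = 0 := by
  have hmem : ∀ v, N.graph.Adj u v → ∀ z c, ¬ ∃ m, (N.ident v, m) ∈ (N.state S t u).inbox ∧
      m.report = some (j, z, c) := by
    rintro v hadj z c ⟨m, hm, hrep⟩
    obtain ⟨s, hs, rfl⟩ := (N.mem_inbox_ident S hadj).1 hm
    obtain ⟨r, hr, hjr, -⟩ := (hB.report_eq_some_iff hlat).1 hrep
    exact hj ⟨r, hr, hjr⟩
  have hsize : ∀ v, N.graph.Adj u v → (N.state S t u).childSize j (N.ident v) = 0 := by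
    intro v hadj
    unfold NodeState.childSize
    simp only [exists_comm (α := Packet), hmem v hadj]
    simp
  have hcost : ∀ v, N.graph.Adj u v → (N.state S t u).childCost j (N.ident v) = 0 := by
    intro v hadj
    unfold NodeState.childCost
    simp only [exists_comm (α := Packet), hmem v hadj]
    simp
  constructor
  · unfold NodeState.size
    rw [state_input, sum_links, Finset.sum_eq_zero fun v hv => hsize v (by simpa using hv),
      add_zero]
    exact if_congr Iff.rfl rfl rfl
  · unfold NodeState.cost
    rw [state_input, sum_links]
    refine Finset.sum_eq_zero fun v hv => ?_
    have hadj : N.graph.Adj u v := by simpa using hv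
    rw [hsize v hadj, hcost v hadj]
    simp

theorem result_eq (hB : N.IsStart S r₀ B) (hlat : N.LatencyLeWeight) (hS : S.Nonempty) {t : ℕ}
    (ht : 4 * B ≤ t) (u : V) :
    (N.state S t u).result = (N.state S (4 * B) u).result := by
  have hroute : (N.state S t u).route = (N.state S (4 * B) u).route := by
    funext j
    by_cases hj : ∃ r ∈ S, j = N.ident r
    · obtain ⟨r, hr, rfl⟩ := hj
      rw [hB.route_eq hlat (by omega) hr, hB.route_eq hlat (by omega) hr]
    · rw [route_eq_none hlat hj, route_eq_none hlat hj]
  have hcosts : ∀ j, (N.state S t u).size j = (N.state S (4 * B) u).size j ∧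
      (N.state S t u).cost j = (N.state S (4 * B) u).cost j := by
    intro j
    by_cases hj : ∃ r ∈ S, j = N.ident r
    · obtain ⟨r, hr, rfl⟩ := hj
      have h1 := hB.size_eq_and_cost_eq hlat hr (t := t) (u := u) (by omega)
      have h2 := hB.size_eq_and_cost_eq hlat hr (t := 4 * B) (u := u) (by omega)
      exact ⟨h1.1.trans h2.1.symm, h1.2.trans h2.2.symm⟩
    · have h1 := hB.size_eq_and_cost_eq_of_not_source hlat hj t u
      have h2 := hB.size_eq_and_cost_eq_of_not_source hlat hj (4 * B) u
      exact ⟨h1.1.trans h2.1.symm, h1.2.trans h2.2.symm⟩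
  obtain ⟨r, hr⟩ := N.exists_isCheapest hS
  have hd := hB.dist_le hlat hr.1 u
  unfold NodeState.result
  rw [hB.best_eq hlat hr (t := t) (by omega), hB.best_eq hlat hr (t := 4 * B) (by omega)]
  simp only [Result.mk.injEq, and_true]
  refine ⟨?_, ?_, funext fun j => (hcosts j).1, funext fun j => (hcosts j).2⟩
  · funext j
    unfold NodeState.parent
    rw [hroute]
  · rw [hroute]

theorem parent_eq_some_iff (hB : N.IsStart S r₀ B) (hlat : N.LatencyLeWeight) {r u v : V}
    (hr : r ∈ S) : (N.state S (4 * B) u).result.parent (N.ident r) = some (N.ident v) ↔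
      u ≠ r ∧ N.parentOf r u = v :=
  Network.parent_eq_some_iff hlat hr ((hB.slot_le hlat hr u).trans (by omega))

theorem storesTree (hB : N.IsStart S r₀ B) (hlat : N.LatencyLeWeight) {r : V} (hr : r ∈ S) :
    N.StoresTree (fun u => (N.state S (4 * B) u).result) r (parentTree (N.isParentMap r).adj) := by
  refine ⟨(N.isParentMap r).isShortestPathTree N.weight_pos, fun u => ?_, ?_, fun u v => ?_⟩
  · change (((N.state S (4 * B) u).route (N.ident r)).getD (0, 0)).1 = _
    rw [hB.route_eq hlat (by omega) hr]
    rfl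
  · change ((N.state S (4 * B) r).route (N.ident r)).bind _ = none
    rw [hB.route_eq hlat (by omega) hr, Option.bind_some, parentIdent, if_pos rfl, if_pos rfl]
  · rw [hB.parent_eq_some_iff hlat hr, hB.parent_eq_some_iff hlat hr]
    rfl

theorem storesCosts (hB : N.IsStart S r₀ B) (hlat : N.LatencyLeWeight) {r : V} (hr : r ∈ S) :
    N.StoresCosts S (fun u => (N.state S (4 * B) u).result) r := by
  have hchildren : ∀ u, N.children (fun u => (N.state S (4 * B) u).result) r u =
      childrenOf r (N.parentOf r) u := by
    intro u
    ext c
    rw [mem_childrenOf, ← hB.parent_eq_some_iff hlat hr]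
    simp [children]
  have hsize : ∀ u, (N.state S (4 * B) u).result.subtreeSize (N.ident r) =
      subtreeCount S (N.parentOf r) u := fun u =>
    (hB.size_eq_and_cost_eq hlat hr (by omega)).1
  have hcost : ∀ u, (N.state S (4 * B) u).result.subtreeCost (N.ident r) =
      subtreeRoutingCost N.weight S r (N.parentOf r) u := fun u =>
    (hB.size_eq_and_cost_eq hlat hr (by omega)).2
  intro u
  simp only [hchildren, hsize, hcost]
  refine ⟨?_, (N.isParentMap r).subtreeRoutingCost_rec N.weight_pos S u⟩
  rw [(N.isParentMap r).subtreeCount_rec N.weight_pos]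

end IsStart

end Results

end Network

end MRCT

end

/-! ### The main theorem -/

theorem theorem5 :
    ∃ (A : MRCT.Algorithm MRCT.Result) (C : ℕ), ∀ a : ℕ, ∃ b : ℕ,
      ∀ (V : Type) [Fintype V] (N : MRCT.Network V) (S : Finset V),
        S.Nonempty →
        (∀ v, N.ident v ≤ Fintype.card V ^ a) →
        (N.UniformWeights ∨ N.TransmissionWeights) →
        N.BandwidthAtMost S A (b * Nat.log 2 (Fintype.card V + N.diam)) ∧
        ∃ (out : V → MRCT.Result) (T : V → N.graph.Subgraph) (best : V),
          -- all nodes terminate within `O(|S| + D_ω)` rounds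
          N.TerminatesWithin S A (C * (S.card + N.diam)) out ∧
          -- shortest-path trees from all nodes of `S`, with recursively computed routing costs
          (∀ r ∈ S, N.StoresTree out r (T r) ∧ N.StoresCosts S out r ∧
            2 * (out r).subtreeCost (N.ident r) = MRCT.routingCost N.weight S (T r)) ∧
          -- the cheapest of these trees is selected, and every node knows it
          best ∈ S ∧ (∀ u, (out u).best = N.ident best) ∧
          (∀ r ∈ S, MRCT.routingCost N.weight S (T best) ≤ MRCT.routingCost N.weight S (T r)) ∧
          -- the selected tree is a 2-approximation
          MRCT.SpansAsTree N.graph S (T best) ∧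
          MRCT.IsMulApprox 2 (MRCT.optRoutingCost N.graph N.weight S)
            (MRCT.routingCost N.weight S (T best)) := by
  -- All nodes stop at time `4 * B`, and `B ≤ 2 * (D + |S|)`.
  refine ⟨MRCT.mrct, 8, fun a => ⟨128 * (a + 3) + 16, fun V _ N S hS hident hmodel => ?_⟩⟩
  have hlat : N.LatencyLeWeight := hmodel.elim
    MRCT.Network.UniformWeights.latencyLeWeight MRCT.Network.TransmissionWeights.latencyLeWeight
  obtain ⟨r₀, B, hB, hle⟩ := MRCT.Network.exists_isStart hlat hS
  obtain ⟨best, hbest⟩ := N.exists_isCheapest hS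
  have hcost : ∀ r, 2 * N.rootCost S r =
      MRCT.routingCost N.weight S (MRCT.parentTree (N.isParentMap r).adj) := fun r =>
    (N.isParentMap r).two_mul_subtreeRoutingCost_root N.weight_pos S
  have hmin : ∀ r ∈ S, MRCT.routingCost N.weight S (MRCT.parentTree (N.isParentMap best).adj) ≤
      MRCT.routingCost N.weight S (MRCT.parentTree (N.isParentMap r).adj) := by
    intro r hr
    rw [← hcost, ← hcost]
    have := hbest.2 r hr
    omega
  refine ⟨MRCT.Network.bandwidthAtMost hlat hS hident,
    fun u => (N.state S (4 * B) u).result,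
    fun r => MRCT.parentTree (N.isParentMap r).adj, best,
    hB.terminatesWithin hlat (by omega) fun t u ht => hB.result_eq hlat hS ht u,
    fun r hr => ⟨hB.storesTree hlat hr, hB.storesCosts hlat hr, ?_⟩, hbest.1, fun u => ?_, hmin,
    ((N.isParentMap best).isShortestPathTree N.weight_pos).spansAsTree S,
    MRCT.isMulApprox_of_forall_le _
      (fun r _ => (N.isParentMap r).isShortestPathTree N.weight_pos) hbest.1 hmin⟩
  · rw [← hcost]
    exact congrArg (2 * ·) (hB.size_eq_and_cost_eq hlat hr (by omega)).2
  · change ((N.state S (4 * B) u).best.getD (0, 0)).2 = _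
    have hd := hB.dist_le hlat hbest.1 u
    rw [hB.best_eq hlat hbest (by omega)]
    rfl
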